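/- Let $1<p<2$, $d,m\in\mathbb N$, and equip $\mathbb R^d,\mathbb R^m$ with Euclidean norms and matrices with the operator norm $|\cdot|$ (also written $\|\cdot\|$). For a path $z$ on $[a,b]$ let $|||z|||_{p\text{-var},[a,b]}=\big(\sup\sum_i\|z_{t_{i+1}}-z_{t_i}\|^p\big)^{1/p}$, the supremum being over all finite partitions $a=t_0<\dots<t_n=b$, and put $\|z\|_{p\text{-var},[a,b]}=\|z_a\|+|||z|||_{p\text{-var},[a,b]}$ and $\|z\|_{\infty,[a,b]}=\sup_{t\in[a,b]}\|z_t\|$. Let $A\in\mathbb R^{d\times d}$, let $f:\mathbb R^d\to\mathbb R^d$ and $g:\mathbb R^d\to\mathbb R^{d\times m}$ be globally Lipschitz with Lipschitz constants $C_f$ and $C_g$, let $g$ be $C^1$ with globally Lipschitz derivative, and let $x:\mathbb R\to\mathbb R^m$ be continuous with finite $p$-variation on every compact interval. (i) For every $y_0\in\mathbb R^d$ the Young equation $$y_t=y_0+\int_0^t[Ay_s+f(y_s)]\,ds+\int_0^t g(y_s)\,dx_s,\qquad t\ge 0,$$ has exactly one solution $y$ on $[0,\infty)$ among the continuous paths of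 finite $p$-variation on compact intervals; here $\int_0^t g(y_s)\,dx_s$ is the Young integral, the limit of the left-point sums $\sum_i g(y_{t_i})(x_{t_{i+1}}-x_{t_i})$ over finite partitions of $[0,t]$ as the mesh tends to $0$. (ii) Assume that $C_g>0$ and $L:=|A|+C_f>0$, and put $$K=(1-2^{1-2/p})^{-1},\quad \alpha=\log\Big(1+\frac1{K+1}\Big),\quad \gamma=\frac1{2(K+1)C_g},\quad M_0=\frac{\|f(0)\|}{L}+\frac{\|g(0)\|}{(K+1)C_g}.$$ For $0\le a<b$ define the greedy times $\tau_0=a$, $\tau_{k+1}=\min\{b,\ \inf\{t>\tau_k:\ |||x|||_{p\text{-var},[\tau_k,t]}=\gamma\}\}$ (with $\inf\emptyset=+\infty$), and let $N=N_{[a,b]}(x)$ be the least $k$ with $\tau_k=b$. Then $N$ is finite, and every solution $y$ satisfies $$\|y\|_{\infty,[a,b]}\le\big[\|y_a\|+M_0N\big]e^{\alpha N+2L(b-a)},$$ $$\|y\|_{p\text{-var},[a,b]}\le\big[\|y_a\|+M_0N\big]e^{\alpha N+2L(b-a)}\,N^{\frac{p-1}{p}}.$$ -/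

import Mathlib

open scoped NNReal ENNReal

noncomputable section

namespace YDE

/-- `t 0 = a, …, t n = b` are the nodes of a finite partition of `[a, b]`. Repeated nodes are
allowed: they contribute zero terms to all the sums below, so that the suprema and limits are the
same as over strictly increasing nodes, and the one-point interval has partitions too. -/
def IsPartition (a b : ℝ) (n : ℕ) (t : ℕ → ℝ) : Prop :=
  t 0 = a ∧ t n = b ∧ ∀ i < n, t i ≤ t (i + 1)

/-- The `p`-variation seminorm of `x` on `[a, b]`, with values in `[0, ∞]`. -/
def pVar {E : Type*} [NormedAddCommGroup E] (p : ℝ) (x : ℝ → E) (a b : ℝ) : ℝ≥0∞ :=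
  (⨆ (n : ℕ) (t : ℕ → ℝ) (_ : IsPartition a b n t),
    ∑ i ∈ Finset.range n, ‖x (t (i + 1)) - x (t i)‖ₑ ^ p) ^ (1 / p)

/-- The `p`-variation norm `‖x a‖ + pVar p x a b`. -/
def pVarNorm {E : Type*} [NormedAddCommGroup E] (p : ℝ) (x : ℝ → E) (a b : ℝ) : ℝ≥0∞ :=
  ‖x a‖ₑ + pVar p x a b

/-- The supremum norm of `x` on `[a, b]`. -/
def supNorm {E : Type*} [NormedAddCommGroup E] (x : ℝ → E) (a b : ℝ) : ℝ≥0∞ :=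
  ⨆ t ∈ Set.Icc a b, ‖x t‖ₑ

/-- `I` is the Young integral `∫_a^b Y dx`: the limit of the left-point sums
`∑ Y (t i) (x (t (i + 1)) - x (t i))` over the finite partitions of `[a, b]`, as the mesh
tends to zero. -/
def HasYoungIntegral {E F : Type*} [NormedAddCommGroup E] [NormedSpace ℝ E]
    [NormedAddCommGroup F] [NormedSpace ℝ F]
    (Y : ℝ → E →L[ℝ] F) (x : ℝ → E) (a b : ℝ) (I : F) : Prop :=
  ∀ ε > 0, ∃ δ > 0, ∀ (n : ℕ) (t : ℕ → ℝ), IsPartition a b n t →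
    (∀ i < n, t (i + 1) - t i < δ) →
    ‖∑ i ∈ Finset.range n, Y (t i) (x (t (i + 1)) - x (t i)) - I‖ < ε

/-- `y` is a solution on `[0, ∞)` of `dy = (A y + f y) dt + g y dx`: a continuous path which has
finite `p`-variation on every `[0, T]` and satisfies
`y t = y 0 + ∫_0^t (A (y s) + f (y s)) ds + ∫_0^t g (y s) dx s` for all `t ≥ 0`, where the last
integral is a Young integral. Only the values of `y` on `[0, ∞)` matter. -/
def IsSolution {E F : Type*} [NormedAddCommGroup E] [NormedSpace ℝ E]
    [NormedAddCommGroup F] [NormedSpace ℝ F]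
    (p : ℝ) (A : F →L[ℝ] F) (f : F → F) (g : F → E →L[ℝ] F) (x : ℝ → E) (y : ℝ → F) : Prop :=
  ContinuousOn y (Set.Ici 0) ∧
  (∀ T : ℝ, 0 ≤ T → pVar p y 0 T < ∞) ∧
  ∀ t : ℝ, 0 ≤ t → ∃ I : F, HasYoungIntegral (fun s => g (y s)) x 0 t I ∧
    y t = y 0 + (∫ s in (0 : ℝ)..t, (A (y s) + f (y s))) + I

/-- The greedy times `τ 0 = a`, `τ (k + 1) = inf {t > τ k | pVar p x (τ k) t = γ} ∧ b`. The point
`b` is put into the set, so that the infimum over an empty set of hitting times gives `b`. -/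
def greedyTime {E : Type*} [NormedAddCommGroup E] (p γ : ℝ) (x : ℝ → E) (a b : ℝ) : ℕ → ℝ
  | 0 => a
  | k + 1 => sInf (insert b {t : ℝ | greedyTime p γ x a b k < t ∧
      pVar p x (greedyTime p γ x a b k) t = ENNReal.ofReal γ})

/-- The number of greedy times: the least `k` with `τ k = b`. -/
def greedyCount {E : Type*} [NormedAddCommGroup E] (p γ : ℝ) (x : ℝ → E) (a b : ℝ) : ℕ :=
  sInf {k : ℕ | greedyTime p γ x a b k = b}

/-- `K = (1 - 2 ^ (1 - 2 / p))⁻¹`. -/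
def constK (p : ℝ) : ℝ := (1 - (2 : ℝ) ^ (1 - 2 / p))⁻¹

/-- `α = log (1 + 1 / (K + 1))`. -/
def constAlpha (p : ℝ) : ℝ := Real.log (1 + 1 / (constK p + 1))

/-- `γ = 1 / (2 (K + 1) C_g)`. -/
def constGamma (p Cg : ℝ) : ℝ := 1 / (2 * (constK p + 1) * Cg)

/-- `M₀ = ‖f 0‖ / L + ‖g 0‖ / ((K + 1) C_g)`, where `f0` and `g0` stand for the two norms. -/
def constM0 (p L Cg f0 g0 : ℝ) : ℝ := f0 / L + g0 / ((constK p + 1) * Cg)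

end YDE

end

open scoped NNReal ENNReal

noncomputable section

namespace YDE

/-! The argument rests on controls: functions `κ s t` whose `p`-th power is superadditive. If the
increments of a path are bounded by a control, so is its `p`-variation (`pVar_le_of_ctl`). Hence
every variation estimate reduces to an estimate of a single increment.

The Young integral comes from sewing. The germ `Y s (x t - x s)` fails to be additive by at most the
product of the variations of `Y` and `x`, which is a control of exponent `p / 2 < 1`. Such a germ
lies close to an additive function (`exists_additive`). Bisecting the control rather than time
improves the distance to the constant `K` (`norm_additive_sub_germ_le`), and Riemann sums converge
to that function (`riemann_sums_tendsto`).

For the growth bound, let `D` be the variation of a solution over an interval where `x` has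
variation at most `γ`. The Young–Loève estimate bounds `D` by the drift, a term in the initial
value, and `γ (K + 1) C_g D = D / 2`. Absorbing the last term doubles the rest, and Gronwall's
inequality at rate `2L` gives a factor `e^α e^{2L(t-s)}` and an additive `M₀` per interval
(`SolOn.norm_add_pv_le_of_small`). Variation is subadditive over adjacent intervals, so these bounds
chain along the greedy times (`SolOn.norm_add_pv_le`).

For well-posedness, a four-point estimate for `g` makes the Picard map Lipschitz in the variation
seminorm, with a small constant on short intervals (`pv_picard_sub_le`). This gives uniqueness and
local existence. The growth bound keeps the local step length away from zero, so finitely many steps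
reach any time. -/

open Filter Topology Set

/-! ### Controls: functions with superadditive `p`-th power -/

section Control

/-- Two-parameter functions whose `p`-th power is superadditive. -/
structure IsCtl (p : ℝ) (κ : ℝ → ℝ → ℝ) : Prop where
  nonneg : ∀ s t, s ≤ t → 0 ≤ κ s t
  superadd : ∀ s u t, s ≤ u → u ≤ t → κ s u ^ p + κ u t ^ p ≤ κ s t ^ p

variable {p : ℝ} {κ κ₁ κ₂ : ℝ → ℝ → ℝ}

/-- Minkowski's inequality in the plane for the vectors `(a, c)` and `(b, d)`. It is what makes a
sum of controls a control. -/
lemma minkowski_two (hp : 1 ≤ p) {a b c d : ℝ} (ha : 0 ≤ a) (hb : 0 ≤ b) (hc : 0 ≤ c)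
    (hd : 0 ≤ d) :
    (a + b) ^ p + (c + d) ^ p ≤ ((a ^ p + c ^ p) ^ (1 / p) + (b ^ p + d ^ p) ^ (1 / p)) ^ p := by
  have hp0 : 0 < p := by linarith
  have h := Real.Lp_add_le_of_nonneg (s := (Finset.univ : Finset (Fin 2))) (f := ![a, c])
    (g := ![b, d]) hp (by intro i _; fin_cases i <;> simpa) (by intro i _; fin_cases i <;> simpa)
  simp only [Fin.sum_univ_two, Matrix.cons_val_zero, Matrix.cons_val_one] at h
  have h2 := Real.rpow_le_rpow (by positivity) h hp0.le
  rwa [← Real.rpow_mul (by positivity), one_div_mul_cancel hp0.ne', Real.rpow_one] at h2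

lemma IsCtl.add (hp : 1 ≤ p) (h₁ : IsCtl p κ₁) (h₂ : IsCtl p κ₂) :
    IsCtl p (fun s t => κ₁ s t + κ₂ s t) where
  nonneg s t h := add_nonneg (h₁.nonneg s t h) (h₂.nonneg s t h)
  superadd s u t hsu hut := by
    have hp0 : 0 < p := by linarith
    have key : ∀ {κ : ℝ → ℝ → ℝ}, IsCtl p κ → (κ s u ^ p + κ u t ^ p) ^ (1 / p) ≤ κ s t := by
      intro κ h
      rw [one_div, Real.rpow_inv_le_iff_of_pos _ (h.nonneg _ _ (hsu.trans hut)) hp0]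
      · exact h.superadd s u t hsu hut
      · have := h.nonneg _ _ hsu
        have := h.nonneg _ _ hut
        positivity
    have a1 := h₁.nonneg _ _ hsu
    have a2 := h₁.nonneg _ _ hut
    have a3 := h₂.nonneg _ _ hsu
    have a4 := h₂.nonneg _ _ hut
    refine (minkowski_two hp a1 a3 a2 a4).trans ?_
    exact Real.rpow_le_rpow (by positivity) (add_le_add (key h₁) (key h₂)) hp0.le

lemma IsCtl.smul {c : ℝ} (hc : 0 ≤ c) (h : IsCtl p κ) : IsCtl p (fun s t => c * κ s t) where
  nonneg s t hst := mul_nonneg hc (h.nonneg s t hst)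
  superadd s u t hsu hut := by
    have h1 := h.nonneg _ _ hsu
    have h2 := h.nonneg _ _ hut
    have h3 := h.nonneg _ _ (hsu.trans hut)
    rw [Real.mul_rpow hc h1, Real.mul_rpow hc h2, Real.mul_rpow hc h3, ← mul_add]
    exact mul_le_mul_of_nonneg_left (h.superadd s u t hsu hut) (by positivity)

lemma IsCtl.comp {c : ℝ → ℝ} (hc : Monotone c) (h : IsCtl p κ) :
    IsCtl p (fun s t => κ (c s) (c t)) where
  nonneg _ _ hst := h.nonneg _ _ (hc hst)
  superadd _ _ _ hsu hut := h.superadd _ _ _ (hc hsu) (hc hut)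

lemma IsCtl.of_monotone (hp : 1 ≤ p) {Φ : ℝ → ℝ} (hΦ : Monotone Φ) :
    IsCtl p (fun s t => Φ t - Φ s) where
  nonneg s t hst := sub_nonneg.2 (hΦ hst)
  superadd s u t hsu hut := by
    have := Real.add_rpow_le_rpow_add (sub_nonneg.2 (hΦ hsu)) (sub_nonneg.2 (hΦ hut)) hp
    refine this.trans (le_of_eq ?_)
    congr 1
    ring

lemma IsCtl.sum_le (h : IsCtl p κ) {t : ℕ → ℝ} :
    ∀ n : ℕ, (∀ i < n, t i ≤ t (i + 1)) →
      t 0 ≤ t n ∧ ∑ i ∈ Finset.range n, κ (t i) (t (i + 1)) ^ p ≤ κ (t 0) (t n) ^ p := by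
  intro n
  induction n with
  | zero =>
    intro _
    have := h.nonneg (t 0) (t 0) le_rfl
    simp only [Finset.range_zero, Finset.sum_empty, le_refl, true_and]
    positivity
  | succ n ih =>
    intro hn
    obtain ⟨h1, h2⟩ := ih (fun i hi => hn i (by omega))
    have h3 := hn n (by omega)
    refine ⟨h1.trans h3, ?_⟩
    rw [Finset.sum_range_succ]
    exact (add_le_add_left h2 _).trans (h.superadd _ _ _ h1 h3)

lemma IsCtl.mono (hp : 0 < p) (h : IsCtl p κ) {s u v t : ℝ} (hsu : s ≤ u) (huv : u ≤ v)
    (hvt : v ≤ t) : κ u v ≤ κ s t := by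
  have h1 := h.superadd s u v hsu huv
  have h2 := h.superadd s v t (hsu.trans huv) hvt
  have h3 := Real.rpow_nonneg (h.nonneg _ _ hsu) p
  have h4 := Real.rpow_nonneg (h.nonneg _ _ hvt) p
  have h5 := h.nonneg _ _ huv
  have h6 := h.nonneg _ _ (hsu.trans (huv.trans hvt))
  exact (Real.rpow_le_rpow_iff h5 h6 hp).1 (by linarith)

end Control

/-! ### Partitions of an interval -/

section Partition

variable {a b : ℝ} {n : ℕ} {t : ℕ → ℝ}

lemma IsPartition.monotoneOn (h : IsPartition a b n t) :
    ∀ {i j : ℕ}, i ≤ j → j ≤ n → t i ≤ t j := by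
  intro i j hij hj
  induction j, hij using Nat.le_induction with
  | base => exact le_rfl
  | succ j hij ih => exact (ih (by omega)).trans (h.2.2 j (by omega))

lemma IsPartition.le (h : IsPartition a b n t) : a ≤ b := by
  have := h.monotoneOn (Nat.zero_le n) le_rfl
  rwa [h.1, h.2.1] at this

lemma IsPartition.mem (h : IsPartition a b n t) {i : ℕ} (hi : i ≤ n) : t i ∈ Icc a b := by
  have h1 := h.monotoneOn (Nat.zero_le i) hi
  have h2 := h.monotoneOn hi le_rfl
  rw [h.1] at h1
  rw [h.2.1] at h2
  exact ⟨h1, h2⟩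

lemma IsPartition.comp (h : IsPartition a b n t) {c : ℝ → ℝ} (hc : Monotone c) :
    IsPartition (c a) (c b) n (fun i => c (t i)) :=
  ⟨by simp [h.1], by simp [h.2.1], fun i hi => hc (h.2.2 i hi)⟩

lemma isPartition_two (hab : a ≤ b) :
    IsPartition a b 1 (fun i => if i = 0 then a else b) := by
  refine ⟨by simp, by simp, fun i hi => ?_⟩
  obtain rfl : i = 0 := by omega
  simpa using hab

lemma IsPartition.append {c : ℝ} {m : ℕ} {u : ℕ → ℝ} (h₁ : IsPartition a b n t)
    (h₂ : IsPartition b c m u) (w : ℝ → ℝ → ℝ) :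
    ∃ v : ℕ → ℝ, IsPartition a c (n + m) v ∧
      ∑ i ∈ Finset.range (n + m), w (v i) (v (i + 1)) =
        ∑ i ∈ Finset.range n, w (t i) (t (i + 1)) + ∑ i ∈ Finset.range m, w (u i) (u (i + 1)) := by
  set v : ℕ → ℝ := fun i => if i ≤ n then t i else u (i - n) with hv
  have v1 : ∀ i, i ≤ n → v i = t i := fun i hi => by simp [hv, hi]
  have v2 : ∀ i, v (n + i) = u i := by
    intro i
    rcases Nat.eq_zero_or_pos i with rfl | hi
    · rw [Nat.add_zero, v1 n le_rfl, h₁.2.1, h₂.1]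
    · have : ¬ n + i ≤ n := by omega
      simp [hv, this]
  refine ⟨v, ⟨by rw [v1 0 (by omega), h₁.1], by rw [v2, h₂.2.1], fun i hi => ?_⟩, ?_⟩
  · rcases lt_or_ge i n with hin | hin
    · rw [v1 i hin.le, v1 (i + 1) hin]
      exact h₁.2.2 i hin
    · obtain ⟨j, rfl⟩ := Nat.exists_eq_add_of_le hin
      rw [v2, add_assoc, v2]
      exact h₂.2.2 j (by omega)
  · rw [Finset.sum_range_add]
    congr 1
    · refine Finset.sum_congr rfl fun i hi => ?_
      have := Finset.mem_range.1 hi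
      rw [v1 i (by omega), v1 (i + 1) (by omega)]
    · refine Finset.sum_congr rfl fun i _ => ?_
      rw [v2, add_assoc, v2]

end Partition

/-! ### The `p`-variation of continuous paths -/

section Variation

variable {E : Type*} [NormedAddCommGroup E] {p : ℝ} {x y z : ℝ → E} {a b : ℝ}

/-- The `p`-variation seminorm as a real number. -/
def pv (p : ℝ) (x : ℝ → E) (a b : ℝ) : ℝ := (pVar p x a b).toReal

lemma pv_nonneg : 0 ≤ pv p x a b := ENNReal.toReal_nonneg

/-- Continuous paths of finite `p`-variation on all compact intervals. -/
structure FinVar (p : ℝ) (x : ℝ → E) : Prop where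
  cont : Continuous x
  fin : ∀ a b, pVar p x a b ≠ ∞

lemma ofReal_sum_incr (hp : 0 ≤ p) (x : ℝ → E) (n : ℕ) (t : ℕ → ℝ) :
    ∑ i ∈ Finset.range n, ‖x (t (i + 1)) - x (t i)‖ₑ ^ p =
      ENNReal.ofReal (∑ i ∈ Finset.range n, ‖x (t (i + 1)) - x (t i)‖ ^ p) := by
  rw [ENNReal.ofReal_sum_of_nonneg (fun i _ => by positivity)]
  refine Finset.sum_congr rfl fun i _ => ?_
  rw [← ofReal_norm, ENNReal.ofReal_rpow_of_nonneg (norm_nonneg _) hp]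

lemma pVar_le_of_sum_le (hp : 0 < p) {C : ℝ} (hC : 0 ≤ C)
    (h : ∀ n t, IsPartition a b n t →
      ∑ i ∈ Finset.range n, ‖x (t (i + 1)) - x (t i)‖ ^ p ≤ C ^ p) :
    pVar p x a b ≤ ENNReal.ofReal C := by
  rw [pVar, one_div, ENNReal.rpow_inv_le_iff hp, ENNReal.ofReal_rpow_of_nonneg hC hp.le]
  refine iSup_le fun n => iSup_le fun t => iSup_le fun ht => ?_
  rw [ofReal_sum_incr hp.le]
  exact ENNReal.ofReal_le_ofReal (h n t ht)

lemma sum_le_of_pVar_ne_top (hp : 0 < p) (hx : pVar p x a b ≠ ∞) {n : ℕ} {t : ℕ → ℝ}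
    (ht : IsPartition a b n t) :
    ∑ i ∈ Finset.range n, ‖x (t (i + 1)) - x (t i)‖ ^ p ≤ pv p x a b ^ p := by
  have h1 : ENNReal.ofReal (∑ i ∈ Finset.range n, ‖x (t (i + 1)) - x (t i)‖ ^ p) ≤
      pVar p x a b ^ p := by
    rw [← ofReal_sum_incr hp.le, pVar, ← ENNReal.rpow_mul, one_div_mul_cancel hp.ne',
      ENNReal.rpow_one]
    exact le_iSup_of_le n (le_iSup_of_le t (le_iSup_of_le ht le_rfl))
  rw [pv, ENNReal.toReal_rpow]
  exact (ENNReal.ofReal_le_iff_le_toReal (by simp [hx, hp.le])).1 h1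

lemma exists_lt_sum (hp : 0 < p) (hab : a ≤ b) {c : ℝ} (hc : c < pv p x a b ^ p) :
    ∃ n t, IsPartition a b n t ∧
      c < ∑ i ∈ Finset.range n, ‖x (t (i + 1)) - x (t i)‖ ^ p := by
  by_contra! hcon
  have hc0 : 0 ≤ c := le_trans (by positivity) (hcon _ _ (isPartition_two hab))
  have h1 : pVar p x a b ≤ ENNReal.ofReal (c ^ (1 / p)) := by
    refine pVar_le_of_sum_le hp (by positivity) fun n t ht => ?_
    rw [← Real.rpow_mul hc0, one_div_mul_cancel hp.ne', Real.rpow_one]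
    exact hcon n t ht
  have h2 : pv p x a b ≤ c ^ (1 / p) := ENNReal.toReal_le_of_le_ofReal (by positivity) h1
  have h3 := Real.rpow_le_rpow pv_nonneg h2 hp.le
  rw [← Real.rpow_mul hc0, one_div_mul_cancel hp.ne', Real.rpow_one] at h3
  linarith

/-- Over any partition the `p`-th powers of the control add up to at most `κ a b ^ p`, by
superadditivity. -/
lemma pVar_le_of_ctl (hp : 0 < p) {κ : ℝ → ℝ → ℝ} (hκ : IsCtl p κ) (hab : a ≤ b)
    (h : ∀ u v, a ≤ u → u ≤ v → v ≤ b → ‖x v - x u‖ ≤ κ u v) :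
    pVar p x a b ≤ ENNReal.ofReal (κ a b) := by
  refine pVar_le_of_sum_le hp (hκ.nonneg _ _ hab) fun n t ht => ?_
  have h1 := (hκ.sum_le n ht.2.2).2
  rw [ht.1, ht.2.1] at h1
  refine (Finset.sum_le_sum fun i hi => ?_).trans h1
  have hi := Finset.mem_range.1 hi
  exact Real.rpow_le_rpow (norm_nonneg _)
    (h _ _ (ht.mem (by omega)).1 (ht.2.2 i hi) (ht.mem (by omega)).2) hp.le

lemma pv_le_of_ctl (hp : 0 < p) {κ : ℝ → ℝ → ℝ} (hκ : IsCtl p κ) (hab : a ≤ b)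
    (h : ∀ u v, a ≤ u → u ≤ v → v ≤ b → ‖x v - x u‖ ≤ κ u v) :
    pv p x a b ≤ κ a b :=
  ENNReal.toReal_le_of_le_ofReal (hκ.nonneg _ _ hab) (pVar_le_of_ctl hp hκ hab h)

/-- There are no partitions, so the supremum is over an empty family. This is why `FinVar` can
require finiteness for all pairs of endpoints. -/
lemma pVar_of_lt (hp : 0 < p) (hab : b < a) : pVar p x a b = 0 := by
  have : pVar p x a b ≤ ENNReal.ofReal 0 :=
    pVar_le_of_sum_le hp le_rfl fun n t ht => absurd ht.le (not_le.2 hab)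
  simpa using this

lemma finVar_of_ctl (hp : 0 < p) {κ : ℝ → ℝ → ℝ} (hκ : IsCtl p κ) (hx : Continuous x)
    (h : ∀ u v, u ≤ v → ‖x v - x u‖ ≤ κ u v) : FinVar p x := by
  refine ⟨hx, fun a b => ?_⟩
  rcases le_or_gt a b with hab | hab
  · exact ne_top_of_le_ne_top ENNReal.ofReal_ne_top
      (pVar_le_of_ctl hp hκ hab fun u v _ huv _ => h u v huv)
  · simp [pVar_of_lt hp hab]

lemma FinVar.ofReal_pv (hx : FinVar p x) : ENNReal.ofReal (pv p x a b) = pVar p x a b :=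
  ENNReal.ofReal_toReal (hx.fin a b)

lemma FinVar.isCtl (hp : 0 < p) (hx : FinVar p x) : IsCtl p (pv p x) where
  nonneg _ _ _ := pv_nonneg
  superadd s u t hsu hut := by
    refine le_of_forall_pos_le_add fun ε hε => ?_
    obtain ⟨n, t₁, h₁, h₁'⟩ := exists_lt_sum (x := x) hp hsu (sub_lt_self _ (half_pos hε))
    obtain ⟨m, t₂, h₂, h₂'⟩ := exists_lt_sum (x := x) hp hut (sub_lt_self _ (half_pos hε))
    obtain ⟨v, hv, hv'⟩ := h₁.append h₂ (fun r q => ‖x q - x r‖ ^ p)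
    have := sum_le_of_pVar_ne_top hp (hx.fin s t) hv
    linarith

lemma FinVar.norm_sub_le (hp : 0 < p) (hx : FinVar p x) (hab : a ≤ b) :
    ‖x b - x a‖ ≤ pv p x a b := by
  have h := sum_le_of_pVar_ne_top hp (hx.fin a b) (isPartition_two hab)
  simp only [Finset.range_one, Finset.sum_singleton, if_true, zero_add, one_ne_zero,
    if_false] at h
  exact (Real.rpow_le_rpow_iff (norm_nonneg _) pv_nonneg hp).1 h

lemma FinVar.mono (hp : 0 < p) (hx : FinVar p x) {s u v t : ℝ} (hsu : s ≤ u) (hvt : v ≤ t) :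
    pv p x u v ≤ pv p x s t := by
  rcases le_or_gt u v with huv | huv
  · exact (hx.isCtl hp).mono hp hsu huv hvt
  · rw [pv, pVar_of_lt hp huv]
    exact pv_nonneg

/-- An increment of `x` is the sum of those of the path stopped at `u` and of the path started at
`u`. Each is bounded by a control, and their sum is a control by Minkowski. -/
lemma FinVar.pv_add_le (hp : 1 ≤ p) (hx : FinVar p x) {s u t : ℝ} (hsu : s ≤ u) (hut : u ≤ t) :
    pv p x s t ≤ pv p x s u + pv p x u t := by
  have hp0 : 0 < p := by linarith
  have hc1 : Monotone (fun r : ℝ => min r u) := fun r q h => min_le_min_right u h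
  have hc2 : Monotone (fun r : ℝ => max r u) := fun r q h => max_le_max_right u h
  have h := pv_le_of_ctl (x := x) hp0
    (((hx.isCtl hp0).comp hc1).add hp ((hx.isCtl hp0).comp hc2)) (hsu.trans hut)
    (fun v w _ hvw _ => ?_)
  · simpa [hsu, hut] using h
  · have e : x w - x v =
        (x (min w u) - x (min v u)) + (x (max w u) - x (max v u)) := by
      rcases le_total v u with h1 | h1 <;> rcases le_total w u with h2 | h2 <;> simp [h1, h2]
    rw [e]
    exact (norm_add_le _ _).trans
      (add_le_add (hx.norm_sub_le hp0 (hc1 hvw)) (hx.norm_sub_le hp0 (hc2 hvw)))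

lemma FinVar.add (hp : 1 ≤ p) (hx : FinVar p x) (hy : FinVar p y) :
    FinVar p (fun t => x t + y t) := by
  have hp0 : 0 < p := by linarith
  refine finVar_of_ctl hp0 ((hx.isCtl hp0).add hp (hy.isCtl hp0)) (hx.cont.add hy.cont)
    fun u v huv => ?_
  have e : x v + y v - (x u + y u) = (x v - x u) + (y v - y u) := by abel
  rw [e]
  exact (norm_add_le _ _).trans (add_le_add (hx.norm_sub_le hp0 huv) (hy.norm_sub_le hp0 huv))

lemma FinVar.sub (hp : 1 ≤ p) (hx : FinVar p x) (hy : FinVar p y) :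
    FinVar p (fun t => x t - y t) := by
  have hp0 : 0 < p := by linarith
  refine finVar_of_ctl hp0 ((hx.isCtl hp0).add hp (hy.isCtl hp0)) (hx.cont.sub hy.cont)
    fun u v huv => ?_
  have e : x v - y v - (x u - y u) = (x v - x u) - (y v - y u) := by abel
  rw [e]
  exact (_root_.norm_sub_le _ _).trans (add_le_add (hx.norm_sub_le hp0 huv) (hy.norm_sub_le hp0 huv))

lemma finVar_const (hp : 1 ≤ p) (c : E) : FinVar p (fun _ : ℝ => c) :=
  finVar_of_ctl (by linarith) (IsCtl.of_monotone hp monotone_const (Φ := fun _ => 0))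
    continuous_const (by simp)

lemma FinVar.comp (hp : 0 < p) (hx : FinVar p x) {c : ℝ → ℝ} (hc : Monotone c)
    (hc' : Continuous c) : FinVar p (fun t => x (c t)) :=
  finVar_of_ctl hp ((hx.isCtl hp).comp hc) (hx.cont.comp hc')
    fun _ _ huv => hx.norm_sub_le hp (hc huv)

lemma FinVar.lipschitz (hp : 0 < p) {F : Type*} [NormedAddCommGroup F] {C : ℝ≥0} {g : E → F}
    (hg : LipschitzWith C g) (hx : FinVar p x) : FinVar p (fun t => g (x t)) :=
  finVar_of_ctl hp ((hx.isCtl hp).smul C.2) (hg.continuous.comp hx.cont)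
    fun _ _ huv => (hg.norm_sub_le _ _).trans
      (mul_le_mul_of_nonneg_left (hx.norm_sub_le hp huv) C.2)

lemma FinVar.pv_lipschitz_le (hp : 0 < p) {F : Type*} [NormedAddCommGroup F] {C : ℝ≥0}
    {g : E → F} (hg : LipschitzWith C g) (hx : FinVar p x) (hab : a ≤ b) :
    pv p (fun t => g (x t)) a b ≤ C * pv p x a b :=
  pv_le_of_ctl hp ((hx.isCtl hp).smul C.2) hab
    fun _ _ _ huv _ => (hg.norm_sub_le _ _).trans
      (mul_le_mul_of_nonneg_left (hx.norm_sub_le hp huv) C.2)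

lemma pVar_congr (h : EqOn x y (Icc a b)) : pVar p x a b = pVar p y a b := by
  unfold pVar
  congr 1
  refine iSup_congr fun n => iSup_congr fun t => iSup_congr fun ht => ?_
  refine Finset.sum_congr rfl fun i hi => ?_
  have := Finset.mem_range.1 hi
  rw [h (ht.mem (i := i + 1) (by omega)), h (ht.mem (i := i) (by omega))]

lemma pVar_comp_le (hp : 0 < p) {c : ℝ → ℝ} (hc : Monotone c) :
    pVar p (fun t => x (c t)) a b ≤ pVar p x (c a) (c b) := by
  unfold pVar
  refine ENNReal.rpow_le_rpow ?_ (by positivity)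
  refine iSup_le fun n => iSup_le fun t => iSup_le fun ht => ?_
  exact le_iSup_of_le n (le_iSup_of_le (fun i => c (t i)) (le_iSup_of_le (ht.comp hc) le_rfl))

/-- Lower semicontinuity of the variation under pointwise convergence. -/
lemma pVar_le_of_tendsto (hp : 0 < p) {ι : Type*} {l : Filter ι} [l.NeBot] {X : ι → ℝ → E}
    (hX : ∀ t ∈ Icc a b, Tendsto (fun i => X i t) l (𝓝 (x t))) {C : ℝ} (hC : 0 ≤ C)
    (hfin : ∀ i, pVar p (X i) a b ≠ ∞) (h : ∀ᶠ i in l, pv p (X i) a b ≤ C) :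
    pVar p x a b ≤ ENNReal.ofReal C := by
  refine pVar_le_of_sum_le hp hC fun n t ht => ?_
  have h1 : Tendsto (fun j => ∑ i ∈ Finset.range n, ‖X j (t (i + 1)) - X j (t i)‖ ^ p) l
      (𝓝 (∑ i ∈ Finset.range n, ‖x (t (i + 1)) - x (t i)‖ ^ p)) := by
    refine tendsto_finsetSum _ fun i hi => ?_
    have := Finset.mem_range.1 hi
    exact (((hX _ (ht.mem (by omega))).sub (hX _ (ht.mem (by omega)))).norm).rpow_const
      (Or.inr hp.le)
  refine le_of_tendsto h1 (h.mono fun j hj => ?_)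
  exact (sum_le_of_pVar_ne_top hp (hfin j) ht).trans (Real.rpow_le_rpow pv_nonneg hj hp.le)

/-- Pushing the nodes of a nearly optimal partition of `[t, t + 1]` up to `u` changes its sum little
when `u` is near `t`, since `x` is continuous. So `[u, t + 1]` carries almost all of the variation,
and superadditivity leaves little for `[t, u]`. -/
lemma FinVar.exists_small_right (hp : 0 < p) (hx : FinVar p x) (t : ℝ) {ε : ℝ} (hε : 0 < ε) :
    ∃ u > t, pv p x t u < ε := by
  have hεp : 0 < ε ^ p := by positivity
  obtain ⟨n, τ, hτ, hlt⟩ := exists_lt_sum (x := x) hp (show t ≤ t + 1 by linarith)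
    (sub_lt_self _ hεp)
  have hcont : Continuous fun u : ℝ =>
      ∑ i ∈ Finset.range n, ‖x (max (τ (i + 1)) u) - x (max (τ i) u)‖ ^ p := by
    refine continuous_finsetSum _ fun i _ => Continuous.rpow_const ?_ fun _ => Or.inr hp.le
    have := hx.cont
    fun_prop
  have h0 : pv p x t (t + 1) ^ p - ε ^ p <
      ∑ i ∈ Finset.range n, ‖x (max (τ (i + 1)) t) - x (max (τ i) t)‖ ^ p := by
    refine hlt.trans_le (Finset.sum_le_sum fun i hi => ?_)
    have := Finset.mem_range.1 hi
    rw [max_eq_left (hτ.mem (i := i + 1) (by omega)).1, max_eq_left (hτ.mem (i := i) (by omega)).1]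
  have h1 := (hcont.tendsto t).eventually (lt_mem_nhds h0)
  have h2 : ∀ᶠ u in 𝓝[>] t, u ∈ Ioo t (t + 1) := Ioo_mem_nhdsGT (by linarith)
  obtain ⟨u, hu1, hu2⟩ := ((h1.filter_mono nhdsWithin_le_nhds).and h2).exists
  refine ⟨u, hu2.1, ?_⟩
  have h3 := hτ.comp (c := fun r => max r u) fun r q h => max_le_max_right u h
  simp only [max_eq_right hu2.1.le, max_eq_left hu2.2.le] at h3
  have h4 := sum_le_of_pVar_ne_top hp (hx.fin _ _) h3
  have h5 := (hx.isCtl hp).superadd t u (t + 1) hu2.1.le hu2.2.le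
  exact (Real.rpow_lt_rpow_iff pv_nonneg hε.le hp).1 (by linarith)

lemma FinVar.exists_small_left (hp : 0 < p) (hx : FinVar p x) (t : ℝ) {ε : ℝ} (hε : 0 < ε) :
    ∃ u < t, pv p x u t < ε := by
  have hεp : 0 < ε ^ p := by positivity
  obtain ⟨n, τ, hτ, hlt⟩ := exists_lt_sum (x := x) hp (show t - 1 ≤ t by linarith)
    (sub_lt_self _ hεp)
  have hcont : Continuous fun u : ℝ =>
      ∑ i ∈ Finset.range n, ‖x (min (τ (i + 1)) u) - x (min (τ i) u)‖ ^ p := by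
    refine continuous_finsetSum _ fun i _ => Continuous.rpow_const ?_ fun _ => Or.inr hp.le
    have := hx.cont
    fun_prop
  have h0 : pv p x (t - 1) t ^ p - ε ^ p <
      ∑ i ∈ Finset.range n, ‖x (min (τ (i + 1)) t) - x (min (τ i) t)‖ ^ p := by
    refine hlt.trans_le (Finset.sum_le_sum fun i hi => ?_)
    have := Finset.mem_range.1 hi
    rw [min_eq_left (hτ.mem (i := i + 1) (by omega)).2, min_eq_left (hτ.mem (i := i) (by omega)).2]
  have h1 := (hcont.tendsto t).eventually (lt_mem_nhds h0)
  have h2 : ∀ᶠ u in 𝓝[<] t, u ∈ Ioo (t - 1) t := Ioo_mem_nhdsLT (by linarith)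
  obtain ⟨u, hu1, hu2⟩ := ((h1.filter_mono nhdsWithin_le_nhds).and h2).exists
  refine ⟨u, hu2.2, ?_⟩
  have h3 := hτ.comp (c := fun r => min r u) fun r q h => min_le_min_right u h
  simp only [min_eq_right hu2.2.le, min_eq_left hu2.1.le] at h3
  have h4 := sum_le_of_pVar_ne_top hp (hx.fin _ _) h3
  have h5 := (hx.isCtl hp).superadd (t - 1) u t hu2.1.le hu2.2.le
  exact (Real.rpow_lt_rpow_iff pv_nonneg hε.le hp).1 (by linarith)

lemma FinVar.continuousOn_pv (hp : 1 ≤ p) (hx : FinVar p x) (s : ℝ) :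
    ContinuousOn (pv p x s) (Ici s) := by
  have hp0 : 0 < p := by linarith
  rw [Metric.continuousOn_iff]
  intro t ht ε hε
  obtain ⟨u, hu, hu'⟩ := hx.exists_small_right hp0 t hε
  obtain ⟨v, hv, hv'⟩ := hx.exists_small_left hp0 t hε
  refine ⟨min (u - t) (t - v), lt_min (by linarith) (by linarith), fun r hr hrt => ?_⟩
  rw [mem_Ici] at ht hr
  rw [Real.dist_eq, abs_lt] at hrt
  have m1 := min_le_left (u - t) (t - v)
  have m2 := min_le_right (u - t) (t - v)
  rw [Real.dist_eq, abs_lt]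
  rcases le_total r t with h | h
  · have h1 := hx.pv_add_le hp hr h
    have h2 := hx.mono hp0 (show v ≤ r by linarith) (le_refl t)
    have h3 := hx.mono hp0 (le_refl s) h
    constructor <;> linarith
  · have h1 := hx.pv_add_le hp ht h
    have h2 := hx.mono hp0 (le_refl t) (show r ≤ u by linarith)
    have h3 := hx.mono hp0 (le_refl s) h
    constructor <;> linarith

lemma FinVar.pv_self (hp : 0 < p) (hx : FinVar p x) : pv p x a a = 0 := by
  have h := (hx.isCtl hp).superadd a a a le_rfl le_rfl
  have h1 : 0 ≤ pv p x a a ^ p := Real.rpow_nonneg pv_nonneg p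
  have h2 : pv p x a a ^ p = 0 := by linarith
  exact (Real.rpow_eq_zero pv_nonneg hp.ne').1 h2

/-- A control that is continuous in its right endpoint is uniformly small on short intervals. -/
lemma IsCtl.exists_small (hp : 0 < p) {κ : ℝ → ℝ → ℝ} (hκ : IsCtl p κ)
    (hc : ContinuousOn (κ a) (Icc a b)) {ε : ℝ} (hε : 0 < ε) :
    ∃ δ > 0, ∀ u v, a ≤ u → u ≤ v → v ≤ b → v - u < δ → κ u v < ε := by
  have h1 : ContinuousOn (fun t => κ a t ^ p) (Icc a b) := hc.rpow_const fun _ _ => Or.inr hp.le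
  -- By superadditivity `κ u v ^ p` is at most the increment of `κ a · ^ p` from `u` to `v`, so
  -- uniform continuity of this one function suffices.
  have h2 := isCompact_Icc.uniformContinuousOn_of_continuous h1
  rw [Metric.uniformContinuousOn_iff] at h2
  obtain ⟨δ, hδ, h⟩ := h2 (ε ^ p) (by positivity)
  refine ⟨δ, hδ, fun u v hu huv hv huv' => ?_⟩
  have h3 := h v ⟨hu.trans huv, hv⟩ u ⟨hu, huv.trans hv⟩
    (by rw [Real.dist_eq, abs_of_nonneg (by linarith)]; exact huv')
  rw [Real.dist_eq, abs_lt] at h3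
  have h4 := hκ.superadd a u v hu huv
  exact (Real.rpow_lt_rpow_iff (hκ.nonneg _ _ huv) hε.le hp).1 (by linarith)

lemma FinVar.exists_small (hp : 1 ≤ p) (hx : FinVar p x) (a b : ℝ) {ε : ℝ} (hε : 0 < ε) :
    ∃ δ > 0, ∀ u v, a ≤ u → u ≤ v → v ≤ b → v - u < δ → pv p x u v < ε :=
  (hx.isCtl (by linarith)).exists_small (by linarith)
    ((hx.continuousOn_pv hp a).mono Icc_subset_Ici_self) hε

end Variation

/-! ### Sewing almost additive germs -/

section Sewing

variable {F : Type*} [NormedAddCommGroup F] {q : ℝ} {κ : ℝ → ℝ → ℝ} {Ξ J : ℝ → ℝ → F}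

lemma IsCtl.self_eq_zero (h : IsCtl q κ) (s : ℝ) : κ s s ^ q = 0 := by
  have h1 := h.superadd s s s le_rfl le_rfl
  have h2 := Real.rpow_nonneg (h.nonneg s s le_rfl) q
  linarith

lemma IsCtl.self (hq : 0 < q) (h : IsCtl q κ) (s : ℝ) : κ s s = 0 :=
  (Real.rpow_eq_zero (h.nonneg s s le_rfl) hq.ne').1 (h.self_eq_zero s)

lemma le_mul_of_rpow_le_half (hq : 0 < q) {a b : ℝ} (ha : 0 ≤ a) (hb : 0 ≤ b)
    (h : a ^ q ≤ b ^ q / 2) : a ≤ (2 : ℝ) ^ (-(1 / q)) * b := by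
  have h1 := Real.rpow_le_rpow (by positivity) h (by positivity : 0 ≤ 1 / q)
  rw [← Real.rpow_mul ha, mul_one_div_cancel hq.ne', Real.rpow_one,
    Real.div_rpow (by positivity) (by norm_num), ← Real.rpow_mul hb, mul_one_div_cancel hq.ne',
    Real.rpow_one] at h1
  rwa [Real.rpow_neg (by norm_num), mul_comm, ← div_eq_mul_inv]

/-- The exponent `1 - 1 / q` is negative. For `q = p / 2` this is where `p < 2` makes the sewing
constants finite. -/
lemma two_mul_rpow_lt_one (hq : 0 < q) (hq1 : q < 1) : 2 * (2 : ℝ) ^ (-(1 / q)) < 1 := by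
  have h1 : 1 < 1 / q := by rw [lt_div_iff₀ hq]; linarith
  have h2 : (2 : ℝ) * (2 : ℝ) ^ (-(1 / q)) = (2 : ℝ) ^ (1 + -(1 / q)) := by
    rw [Real.rpow_add (by norm_num), Real.rpow_one]
  rw [h2]
  exact Real.rpow_lt_one_of_one_lt_of_neg (by norm_num) (by linarith)

lemma germ_self (hq : 0 < q) (hκ : IsCtl q κ)
    (hΞ : ∀ s u t, s ≤ u → u ≤ t → ‖Ξ s t - Ξ s u - Ξ u t‖ ≤ κ s t) (s : ℝ) : Ξ s s = 0 := by
  have h := hΞ s s s le_rfl le_rfl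
  rw [hκ.self hq] at h
  simpa using h

/-- Riemann sums of an almost additive germ are close to the germ. -/
lemma norm_sum_germ_sub_le (hq : 0 < q) (hq1 : q < 1) (hκ : IsCtl q κ)
    (hΞ : ∀ s u t, s ≤ u → u ≤ t → ‖Ξ s t - Ξ s u - Ξ u t‖ ≤ κ s t) {t : ℕ → ℝ}
    (ht : Monotone t) :
    ∀ n i j : ℕ, j = i + n → ‖∑ k ∈ Finset.Ico i j, Ξ (t k) (t (k + 1)) - Ξ (t i) (t j)‖ ≤
      2 / (1 - 2 * (2 : ℝ) ^ (-(1 / q))) * κ (t i) (t j) := by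
  set r : ℝ := (2 : ℝ) ^ (-(1 / q)) with hr
  have hr1 : 2 * r < 1 := two_mul_rpow_lt_one hq hq1
  have hr0 : 0 < r := by positivity
  set C := 2 / (1 - 2 * r) with hC
  have hC0 : 0 < C := div_pos two_pos (by linarith)
  -- The constant solves the recursion below: two subintervals on which the control shrinks by `r`,
  -- and two additivity defects.
  have hCeq : 2 * r * C + 2 = C := by rw [hC]; field_simp [show (1 - 2 * r) ≠ 0 by linarith]; ring
  intro n
  induction n using Nat.strong_induction_on with
  | _ n ih =>
  intro i j hij
  have hnn := hκ.nonneg _ _ (ht (show i ≤ j by omega))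
  rcases Nat.eq_zero_or_pos n with hn | hn
  · obtain rfl : j = i := by omega
    simp only [Finset.Ico_self, Finset.sum_empty, germ_self hq hκ hΞ, sub_zero, norm_zero]
    positivity
  set M := κ (t i) (t j) ^ q with hM
  have hM0 : 0 ≤ M := by positivity
  -- The index `m` is the last one before `j` at which the left part uses at most half of `M`. By
  -- superadditivity the part from `m + 1` on also uses at most half; the step from `m` to `m + 1`
  -- stays undivided.
  obtain ⟨m, him, hmj, hPm, hPk⟩ : ∃ m, i ≤ m ∧ m < j ∧ κ (t i) (t m) ^ q ≤ M / 2 ∧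
      (m + 1 = j ∨ ¬ κ (t i) (t (m + 1)) ^ q ≤ M / 2) := by
    by_contra! hcon
    have hall : ∀ m, i ≤ m → m < j → κ (t i) (t m) ^ q ≤ M / 2 := by
      intro m him
      induction m, him using Nat.le_induction with
      | base => intro _; rw [hκ.self_eq_zero]; positivity
      | succ m him ih2 => intro h; exact (hcon m him (by omega) (ih2 (by omega))).2
    exact (hcon (j - 1) (by omega) (by omega) (hall _ (by omega) (by omega))).1 (by omega)
  have hkj : κ (t (m + 1)) (t j) ^ q ≤ M / 2 := by
    rcases hPk with h | h
    · rw [h, hκ.self_eq_zero]; positivity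
    · have := hκ.superadd _ _ _ (ht (show i ≤ m + 1 by omega)) (ht (show m + 1 ≤ j by omega))
      linarith
  have e1 := le_mul_of_rpow_le_half hq (hκ.nonneg _ _ (ht him)) hnn hPm
  have e2 := le_mul_of_rpow_le_half hq (hκ.nonneg _ _ (ht (show m + 1 ≤ j by omega))) hnn hkj
  have i1 := ih (m - i) (by omega) i m (by omega)
  have i2 := ih (j - (m + 1)) (by omega) (m + 1) j (by omega)
  have d1 := hΞ _ _ _ (ht him) (ht hmj.le)
  have d2 := hΞ _ _ _ (ht (show m ≤ m + 1 by omega)) (ht (show m + 1 ≤ j by omega))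
  have d3 := hκ.mono hq (ht him) (ht hmj.le) (le_refl (t j))
  have hsum : ∑ k ∈ Finset.Ico i j, Ξ (t k) (t (k + 1)) - Ξ (t i) (t j) =
      (∑ k ∈ Finset.Ico i m, Ξ (t k) (t (k + 1)) - Ξ (t i) (t m)) +
      (∑ k ∈ Finset.Ico (m + 1) j, Ξ (t k) (t (k + 1)) - Ξ (t (m + 1)) (t j)) -
      (Ξ (t i) (t j) - Ξ (t i) (t m) - Ξ (t m) (t j)) -
      (Ξ (t m) (t j) - Ξ (t m) (t (m + 1)) - Ξ (t (m + 1)) (t j)) := by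
    rw [← Finset.sum_Ico_consecutive _ him hmj.le, Finset.sum_eq_sum_Ico_succ_bot hmj]
    abel
  rw [hsum]
  refine (norm_sub_le _ _).trans ?_
  refine (add_le_add_left ((norm_sub_le _ _).trans (add_le_add_left (norm_add_le _ _) _)) _).trans ?_
  have f1 := mul_le_mul_of_nonneg_left e1 hC0.le
  have f2 := mul_le_mul_of_nonneg_left e2 hC0.le
  calc _ ≤ C * (r * κ (t i) (t j)) + C * (r * κ (t i) (t j)) + κ (t i) (t j) + κ (t i) (t j) := by
        linarith
    _ = (2 * r * C + 2) * κ (t i) (t j) := by ring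
    _ = _ := by rw [hCeq]

/-- The increasing enumeration is continued by repeating its last value, which makes it monotone on
all of `ℕ`; an extra step there is degenerate. -/
lemma exists_enumeration (D : Finset ℝ) :
    ∃ e : ℕ → ℝ, Monotone e ∧ ∀ u ∈ D, ∃ k < D.card, e k = u := by
  rcases D.eq_empty_or_nonempty with rfl | hD
  · exact ⟨fun _ => 0, monotone_const, by simp⟩
  have hc := hD.card_pos
  refine ⟨fun k => D.orderEmbOfFin rfl ⟨min k (D.card - 1), by omega⟩, fun i j hij => ?_,
    fun u hu => ?_⟩
  · refine (D.orderEmbOfFin rfl).monotone ?_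
    simp only [Fin.mk_le_mk]
    omega
  · have : u ∈ Set.range (D.orderEmbOfFin rfl) := by simpa using hu
    obtain ⟨k, rfl⟩ := this
    refine ⟨k, k.2, ?_⟩
    exact congrArg _ (Fin.ext (by simp only; omega))

/-- An almost additive germ is close to an additive function, obtained as an ultrafilter limit of
Riemann sums along finer and finer partitions. -/
lemma exists_additive [ProperSpace F] (hq : 0 < q) (hq1 : q < 1) (hκ : IsCtl q κ)
    (hΞ : ∀ s u t, s ≤ u → u ≤ t → ‖Ξ s t - Ξ s u - Ξ u t‖ ≤ κ s t) :
    ∃ J : ℝ → ℝ → F, (∀ s u t, s ≤ u → u ≤ t → J s t = J s u + J u t) ∧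
      ∀ s t, s ≤ t → ‖J s t - Ξ s t‖ ≤ 2 / (1 - 2 * (2 : ℝ) ^ (-(1 / q))) * κ s t := by
  classical
  choose e he hmem using exists_enumeration
  have h0 := germ_self hq hκ hΞ
  -- Clamping the nodes to `[s, t]` lets one finite set of nodes serve all intervals simultaneously.
  set c : ℝ → ℝ → ℝ → ℝ := fun s t r => max s (min r t) with hc
  have cmono : ∀ s t, Monotone (c s t) := fun s t r r' h =>
    max_le_max le_rfl (min_le_min_right t h)
  set S : Finset ℝ → ℝ → ℝ → F := fun D s t =>
    ∑ k ∈ Finset.range D.card, Ξ (c s t (e D k)) (c s t (e D (k + 1))) with hS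
  -- The sums eventually stay in a compact ball, so they converge along an ultrafilter without any
  -- Cauchy estimate. Refining `atTop` puts any given point among the nodes eventually.
  set U : Ultrafilter (Finset ℝ) := Ultrafilter.of atTop with hU
  have hUle : (U : Filter (Finset ℝ)) ≤ atTop := Ultrafilter.of_le _
  have hev : ∀ s : ℝ, ∀ᶠ D in (U : Filter (Finset ℝ)), s ∈ D := fun s =>
    hUle ((eventually_ge_atTop {s}).mono fun D hD => hD (Finset.mem_singleton_self s))
  have hbound : ∀ s t, s ≤ t → ∀ᶠ D in (U : Filter (Finset ℝ)),
      S D s t ∈ Metric.closedBall (Ξ s t) (2 / (1 - 2 * (2 : ℝ) ^ (-(1 / q))) * κ s t) := by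
    intro s t hst
    filter_upwards [hev s, hev t] with D hs ht
    obtain ⟨k, hk, hks⟩ := hmem D s hs
    obtain ⟨l, hl, hlt⟩ := hmem D t ht
    have a1 : c s t (e D 0) = s := by
      have : e D 0 ≤ s := hks ▸ he D (Nat.zero_le k)
      simp [hc, this]
    have a2 : c s t (e D D.card) = t := by
      have : t ≤ e D D.card := hlt ▸ he D hl.le
      simp [hc, this, hst]
    have h := norm_sum_germ_sub_le hq hq1 hκ hΞ ((cmono s t).comp (he D)) D.card 0 D.card
      (by omega)
    simp only [Function.comp, a1, a2] at h
    rw [mem_closedBall_iff_norm]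
    simpa [hS] using h
  have hlim : ∀ s t, ∃ I : F, s ≤ t →
      ‖I - Ξ s t‖ ≤ 2 / (1 - 2 * (2 : ℝ) ^ (-(1 / q))) * κ s t ∧
      Tendsto (fun D => S D s t) U (𝓝 I) := by
    intro s t
    by_cases hst : s ≤ t
    · obtain ⟨I, hI, hI'⟩ := (isCompact_closedBall (Ξ s t) _).ultrafilter_le_nhds'
        (U.map fun D => S D s t) (hbound s t hst)
      exact ⟨I, fun _ => ⟨mem_closedBall_iff_norm.1 hI, hI'⟩⟩
    · exact ⟨0, fun h => absurd h hst⟩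
  choose J hJ using hlim
  refine ⟨J, fun s u t hsu hut => ?_, fun s t hst => (hJ s t hst).1⟩
  refine tendsto_nhds_unique (hJ s t (hsu.trans hut)).2
    (((hJ s u hsu).2.add (hJ u t hut).2).congr' ?_)
  filter_upwards [hev u] with D hu
  obtain ⟨j, hj, hju⟩ := hmem D u hu
  simp only [hS, ← Finset.sum_add_distrib]
  refine Finset.sum_congr rfl fun k _ => ?_
  -- Once `u` is a node, each step lies on one side of it. Clamped to the other side the step
  -- degenerates, and the germ vanishes there.
  have b1 : ∀ r ≤ u, c s u r = c s t r ∧ c u t r = u := fun r hr => by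
    simp [hc, hr, hr.trans hut]
  have b2 : ∀ r, u ≤ r → c s u r = u ∧ c u t r = c s t r := fun r hr => by
    have : u ≤ min r t := le_min hr hut
    simp [hc, hr, hsu, this, hsu.trans this]
  rcases lt_or_ge k j with h | h
  · have r1 := b1 (e D k) (hju ▸ he D h.le)
    have r2 := b1 (e D (k + 1)) (hju ▸ he D h)
    rw [r1.1, r1.2, r2.1, r2.2, h0, add_zero]
  · have r1 := b2 (e D k) (hju ▸ he D h)
    have r2 := b2 (e D (k + 1)) (hju ▸ he D (by omega))
    rw [r1.1, r1.2, r2.1, r2.2, h0, zero_add]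

/-- For a continuous control, bisection gives the sharp constant. -/
lemma norm_additive_sub_germ_le (hq : 0 < q) (hq1 : q < 1) (hκ : IsCtl q κ)
    (hκc : ∀ s, ContinuousOn (κ s) (Ici s))
    (hΞ : ∀ s u t, s ≤ u → u ≤ t → ‖Ξ s t - Ξ s u - Ξ u t‖ ≤ κ s t)
    (hJ : ∀ s u t, s ≤ u → u ≤ t → J s t = J s u + J u t) {B : ℝ}
    (hB : ∀ s t, s ≤ t → ‖J s t - Ξ s t‖ ≤ B * κ s t) {s t : ℝ} (hst : s ≤ t) :
    ‖J s t - Ξ s t‖ ≤ (1 - 2 * (2 : ℝ) ^ (-(1 / q)))⁻¹ * κ s t := by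
  set r : ℝ := (2 : ℝ) ^ (-(1 / q)) with hr
  have hr1 : 2 * r < 1 := two_mul_rpow_lt_one hq hq1
  have hr0 : 0 < r := by positivity
  set K := (1 - 2 * r)⁻¹ with hK
  have hK0 : 0 < K := inv_pos.2 (by linarith)
  -- A bisection costs only one defect, against two in the discrete version; hence the smaller
  -- constant.
  have hKeq : 1 + 2 * r * K = K := by
    rw [hK]; field_simp [show (1 - 2 * r) ≠ 0 by linarith]; ring
  have key : ∀ n : ℕ, ∀ s t, s ≤ t → ‖J s t - Ξ s t‖ ≤ (K + (2 * r) ^ n * |B|) * κ s t := by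
    intro n
    induction n with
    | zero =>
      intro s t hst
      refine (hB s t hst).trans (mul_le_mul_of_nonneg_right ?_ (hκ.nonneg _ _ hst))
      have := le_abs_self B
      simp only [pow_zero, one_mul]
      linarith
    | succ n ih =>
      intro s t hst
      have hnn := hκ.nonneg _ _ hst
      -- The interval is halved in terms of the control. Each round multiplies the error from the
      -- crude bound `B` by `2 * r < 1`.
      obtain ⟨u, hu, hu'⟩ : κ s t ^ q / 2 ∈ (fun u => κ s u ^ q) '' Icc s t := by
        refine intermediate_value_Icc hst
          (((hκc s).mono Icc_subset_Ici_self).rpow_const fun _ _ => Or.inr hq.le) ?_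
        simp only [hκ.self_eq_zero]
        have : 0 ≤ κ s t ^ q := by positivity
        constructor <;> linarith
      simp only at hu'
      have hu'' : κ u t ^ q ≤ κ s t ^ q / 2 := by
        have := hκ.superadd s u t hu.1 hu.2
        linarith
      have e1 := le_mul_of_rpow_le_half hq (hκ.nonneg _ _ hu.1) hnn hu'.le
      have e2 := le_mul_of_rpow_le_half hq (hκ.nonneg _ _ hu.2) hnn hu''
      have heq : J s t - Ξ s t =
          (J s u - Ξ s u) + (J u t - Ξ u t) - (Ξ s t - Ξ s u - Ξ u t) := by
        rw [hJ s u t hu.1 hu.2]; abel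
      have hpos : 0 ≤ K + (2 * r) ^ n * |B| := by positivity
      rw [heq]
      refine (norm_sub_le _ _).trans ?_
      refine (add_le_add_left (norm_add_le _ _) _).trans ?_
      have i1 := (ih s u hu.1).trans (mul_le_mul_of_nonneg_left e1 hpos)
      have i2 := (ih u t hu.2).trans (mul_le_mul_of_nonneg_left e2 hpos)
      have i3 := hΞ s u t hu.1 hu.2
      calc _ ≤ (1 + 2 * r * K + (2 * r) ^ (n + 1) * |B|) * κ s t := by
            rw [pow_succ]
            linarith
        _ = _ := by rw [hKeq]
  have hlim : Tendsto (fun n : ℕ => (K + (2 * r) ^ n * |B|) * κ s t) atTop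
      (𝓝 ((K + 0 * |B|) * κ s t)) :=
    ((((tendsto_pow_atTop_nhds_zero_of_lt_one (by positivity) hr1).mul_const _).const_add
      K).mul_const _)
  have := ge_of_tendsto' hlim fun n => key n s t hst
  simpa using this

/-- Riemann sums of a germ converge to the additive function close to it. -/
lemma riemann_sums_tendsto (hq : 0 < q) (hq1 : q < 1) (hκ : IsCtl q κ)
    (hκc : ∀ s, ContinuousOn (κ s) (Ici s))
    (hJ : ∀ s u t, s ≤ u → u ≤ t → J s t = J s u + J u t) {B : ℝ} (hB0 : 0 ≤ B)
    (hB : ∀ s t, s ≤ t → ‖J s t - Ξ s t‖ ≤ B * κ s t) {a b : ℝ} {ε : ℝ} (hε : 0 < ε) :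
    ∃ δ > 0, ∀ (n : ℕ) (t : ℕ → ℝ), IsPartition a b n t → (∀ i < n, t (i + 1) - t i < δ) →
      ‖∑ i ∈ Finset.range n, Ξ (t i) (t (i + 1)) - J a b‖ < ε := by
  -- Writing `κ = κ ^ (1 - q) * κ ^ q`, the first factor is at most `η ^ (1 - q)` for fine meshes
  -- and the second sums to at most `κ a b ^ q`.
  obtain ⟨η, hη0, hη⟩ : ∃ η > 0, B * η ^ (1 - q) * κ a b ^ q < ε := by
    have h1 : Continuous fun η : ℝ => B * η ^ (1 - q) * κ a b ^ q :=
      (continuous_const.mul (continuous_id.rpow_const fun _ => Or.inr (by linarith))).mul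
        continuous_const
    have h2 := h1.tendsto 0
    rw [Real.zero_rpow (by linarith), mul_zero, zero_mul] at h2
    have h3 := (h2.eventually (gt_mem_nhds hε)).filter_mono
      (nhdsWithin_le_nhds (s := Ioi (0 : ℝ)))
    obtain ⟨η, h4, h5⟩ := (h3.and self_mem_nhdsWithin).exists
    exact ⟨η, h5, h4⟩
  obtain ⟨δ, hδ, hsmall⟩ := hκ.exists_small (a := a) (b := b) hq
    ((hκc a).mono Icc_subset_Ici_self) hη0
  refine ⟨δ, hδ, fun n t ht hmesh => ?_⟩
  have hadd : ∀ k ≤ n, J a (t k) = ∑ i ∈ Finset.range k, J (t i) (t (i + 1)) := by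
    intro k
    induction k with
    | zero =>
      intro _
      have := hJ a a a le_rfl le_rfl
      rw [Finset.range_zero, Finset.sum_empty, ht.1]
      simpa using this
    | succ k ih =>
      intro hk
      rw [Finset.sum_range_succ, ← ih (by omega)]
      exact hJ _ _ _ (ht.mem (by omega)).1 (ht.2.2 k (by omega))
  have hs := (hκ.sum_le n ht.2.2).2
  rw [ht.1, ht.2.1] at hs
  rw [← ht.2.1, hadd n le_rfl, ← Finset.sum_sub_distrib]
  refine (norm_sum_le _ _).trans_lt (lt_of_le_of_lt ?_ hη)
  calc ∑ i ∈ Finset.range n, ‖Ξ (t i) (t (i + 1)) - J (t i) (t (i + 1))‖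
      ≤ ∑ i ∈ Finset.range n, B * η ^ (1 - q) * κ (t i) (t (i + 1)) ^ q := by
        refine Finset.sum_le_sum fun i hi => ?_
        have hi := Finset.mem_range.1 hi
        have hle := ht.2.2 i hi
        have h0 := hκ.nonneg _ _ hle
        rw [norm_sub_rev]
        refine (hB _ _ hle).trans ?_
        rw [mul_assoc]
        refine mul_le_mul_of_nonneg_left ?_ hB0
        have h1 := (hsmall _ _ (ht.mem (i := i) (by omega)).1 hle
          (ht.mem (i := i + 1) (by omega)).2 (hmesh i hi)).le
        calc κ (t i) (t (i + 1)) = κ (t i) (t (i + 1)) ^ (1 - q) * κ (t i) (t (i + 1)) ^ q := by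
              rw [← Real.rpow_add' h0 (by simp)]; simp
          _ ≤ _ := mul_le_mul_of_nonneg_right (Real.rpow_le_rpow h0 h1 (by linarith))
              (by positivity)
    _ = B * η ^ (1 - q) * ∑ i ∈ Finset.range n, κ (t i) (t (i + 1)) ^ q := by
        rw [Finset.mul_sum]
    _ ≤ _ := mul_le_mul_of_nonneg_left hs (by positivity)

/-- Cauchy–Schwarz applied to the powers with exponent `p / 2`. -/
lemma IsCtl.mul {p : ℝ} {κ₁ κ₂ : ℝ → ℝ → ℝ} (h₁ : IsCtl p κ₁) (h₂ : IsCtl p κ₂) :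
    IsCtl (p / 2) (fun s t => κ₁ s t * κ₂ s t) where
  nonneg s t h := mul_nonneg (h₁.nonneg s t h) (h₂.nonneg s t h)
  superadd s u t hsu hut := by
    have sq : ∀ {a : ℝ}, 0 ≤ a → (a ^ (p / 2)) ^ 2 = a ^ p := fun {a} ha => by
      rw [← Real.rpow_natCast, ← Real.rpow_mul ha]; congr 1; push_cast; ring
    have a1 := h₁.nonneg _ _ hsu
    have a2 := h₁.nonneg _ _ hut
    have a3 := h₁.nonneg _ _ (hsu.trans hut)
    have b1 := h₂.nonneg _ _ hsu
    have b2 := h₂.nonneg _ _ hut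
    have b3 := h₂.nonneg _ _ (hsu.trans hut)
    have e1 := h₁.superadd s u t hsu hut
    have e2 := h₂.superadd s u t hsu hut
    rw [← sq a1, ← sq a2, ← sq a3] at e1
    rw [← sq b1, ← sq b2, ← sq b3] at e2
    rw [Real.mul_rpow a1 b1, Real.mul_rpow a2 b2, Real.mul_rpow a3 b3]
    generalize κ₁ s u ^ (p / 2) = A1 at *
    generalize κ₁ u t ^ (p / 2) = A2 at *
    generalize κ₂ s u ^ (p / 2) = B1 at *
    generalize κ₂ u t ^ (p / 2) = B2 at *
    have c1 : 0 ≤ κ₁ s t ^ (p / 2) := by positivity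
    have c2 : 0 ≤ κ₂ s t ^ (p / 2) := by positivity
    refine le_of_sq_le_sq ?_ (mul_nonneg c1 c2)
    calc (A1 * B1 + A2 * B2) ^ 2 ≤ (A1 ^ 2 + A2 ^ 2) * (B1 ^ 2 + B2 ^ 2) := by
          nlinarith [sq_nonneg (A1 * B2 - A2 * B1)]
      _ ≤ (κ₁ s t ^ (p / 2)) ^ 2 * (κ₂ s t ^ (p / 2)) ^ 2 := by gcongr
      _ = _ := by ring

end Sewing

/-! ### The Young integral and the Young–Loève estimate -/

section YoungIntegral

variable {E F : Type*} [NormedAddCommGroup E] [NormedSpace ℝ E]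
    [NormedAddCommGroup F] [NormedSpace ℝ F] {p : ℝ} {Y Z : ℝ → E →L[ℝ] F} {x : ℝ → E}
    {a b c : ℝ} {I I' : F}

/-- Equidistant nodes. Without fine partitions the limit defining the Young integral would not be
unique. -/
lemma exists_partition_mesh_lt (hab : a ≤ b) {δ : ℝ} (hδ : 0 < δ) :
    ∃ n t, IsPartition a b n t ∧ ∀ i < n, t (i + 1) - t i < δ := by
  obtain ⟨n, hn⟩ := exists_nat_gt ((b - a) / δ)
  have hn0 : (0 : ℝ) < n := lt_of_le_of_lt (div_nonneg (by linarith) hδ.le) hn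
  have hstep : ∀ i : ℕ, (a + (b - a) * ((i + 1 : ℕ) : ℝ) / n) - (a + (b - a) * i / n) =
      (b - a) / n := fun i => by push_cast; ring
  refine ⟨n, fun i => a + (b - a) * i / n, ⟨by simp, ?_, fun i _ => ?_⟩, fun i _ => ?_⟩
  · simp only
    rw [mul_div_assoc, div_self hn0.ne']
    ring
  · have := hstep i
    have : 0 ≤ (b - a) / n := div_nonneg (by linarith) hn0.le
    linarith
  · simp only
    rw [hstep, div_lt_iff₀ hn0]
    rw [div_lt_iff₀ hδ] at hn
    linarith

lemma HasYoungIntegral.unique (hab : a ≤ b) (h : HasYoungIntegral Y x a b I)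
    (h' : HasYoungIntegral Y x a b I') : I = I' := by
  refine eq_of_forall_dist_le fun ε hε => ?_
  obtain ⟨δ, hδ, h1⟩ := h (ε / 2) (half_pos hε)
  obtain ⟨δ', hδ', h2⟩ := h' (ε / 2) (half_pos hε)
  obtain ⟨n, t, ht, hm⟩ := exists_partition_mesh_lt hab (lt_min hδ hδ')
  have e1 := h1 n t ht fun i hi => (hm i hi).trans_le (min_le_left _ _)
  have e2 := h2 n t ht fun i hi => (hm i hi).trans_le (min_le_right _ _)
  rw [← dist_eq_norm] at e1 e2
  have := dist_triangle_left I I'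
    (∑ i ∈ Finset.range n, Y (t i) (x (t (i + 1)) - x (t i)))
  linarith

lemma HasYoungIntegral.congr {x' : ℝ → E} (h : HasYoungIntegral Y x a b I)
    (hY : EqOn Y Z (Icc a b)) (hx : EqOn x x' (Icc a b)) : HasYoungIntegral Z x' a b I := by
  intro ε hε
  obtain ⟨δ, hδ, h1⟩ := h ε hε
  refine ⟨δ, hδ, fun n t ht hm => ?_⟩
  convert h1 n t ht hm using 3
  refine Finset.sum_congr rfl fun i hi => ?_
  have := Finset.mem_range.1 hi
  rw [hY (ht.mem (i := i) (by omega)), hx (ht.mem (i := i) (by omega)),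
    hx (ht.mem (i := i + 1) (by omega))]

lemma HasYoungIntegral.sub (h : HasYoungIntegral Y x a b I) (h' : HasYoungIntegral Z x a b I') :
    HasYoungIntegral (fun s => Y s - Z s) x a b (I - I') := by
  intro ε hε
  obtain ⟨δ, hδ, h1⟩ := h (ε / 2) (half_pos hε)
  obtain ⟨δ', hδ', h2⟩ := h' (ε / 2) (half_pos hε)
  refine ⟨min δ δ', lt_min hδ hδ', fun n t ht hm => ?_⟩
  have e1 := h1 n t ht fun i hi => (hm i hi).trans_le (min_le_left _ _)
  have e2 := h2 n t ht fun i hi => (hm i hi).trans_le (min_le_right _ _)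
  have e3 := norm_sub_le
    (∑ i ∈ Finset.range n, Y (t i) (x (t (i + 1)) - x (t i)) - I)
    (∑ i ∈ Finset.range n, Z (t i) (x (t (i + 1)) - x (t i)) - I')
  simp only [sub_apply, Finset.sum_sub_distrib]
  rw [sub_sub_sub_comm]
  linarith

lemma constK_eq (p : ℝ) : constK p = (1 - 2 * (2 : ℝ) ^ (-(1 / (p / 2))))⁻¹ := by
  rw [constK, sub_eq_add_neg 1 (2 / p), Real.rpow_add (by norm_num), Real.rpow_one, one_div_div]

lemma constK_pos (hp : 1 ≤ p) (hp2 : p < 2) : 0 < constK p := by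
  rw [constK_eq]
  have := two_mul_rpow_lt_one (q := p / 2) (by linarith) (by linarith)
  exact inv_pos.2 (by linarith)

/-- Young's theorem, with the Young–Loève estimate. -/
theorem exists_youngIntegral [ProperSpace F] (hp : 1 ≤ p) (hp2 : p < 2) (hY : FinVar p Y)
    (hx : FinVar p x) :
    ∃ J : ℝ → ℝ → F, (∀ s u t, s ≤ u → u ≤ t → J s t = J s u + J u t) ∧
      (∀ s t, s ≤ t → HasYoungIntegral Y x s t (J s t)) ∧
      ∀ s t, s ≤ t → ‖J s t - Y s (x t - x s)‖ ≤ constK p * (pv p Y s t * pv p x s t) := by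
  have hp0 : 0 < p := by linarith
  have hq : 0 < p / 2 := by linarith
  have hq1 : p / 2 < 1 := by linarith
  have hκ : IsCtl (p / 2) fun s t => pv p Y s t * pv p x s t := (hY.isCtl hp0).mul (hx.isCtl hp0)
  have hκc : ∀ s, ContinuousOn (fun t => pv p Y s t * pv p x s t) (Ici s) := fun s =>
    (hY.continuousOn_pv hp s).mul (hx.continuousOn_pv hp s)
  have hΞ : ∀ s u t, s ≤ u → u ≤ t →
      ‖Y s (x t - x s) - Y s (x u - x s) - Y u (x t - x u)‖ ≤ pv p Y s t * pv p x s t := by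
    intro s u t hsu hut
    -- The additivity defect is a product of an increment of `Y` and one of `x`, hence the product
    -- control.
    have e : Y s (x t - x s) - Y s (x u - x s) - Y u (x t - x u) =
        -((Y u - Y s) (x t - x u)) := by
      simp only [map_sub, sub_apply]
      abel
    rw [e, norm_neg]
    refine ((Y u - Y s).le_opNorm _).trans ?_
    exact mul_le_mul ((hY.norm_sub_le hp0 hsu).trans (hY.mono hp0 le_rfl hut))
      ((hx.norm_sub_le hp0 hut).trans (hx.mono hp0 hsu le_rfl)) (norm_nonneg _) pv_nonneg
  obtain ⟨J, hJ, hB⟩ := exists_additive hq hq1 hκ hΞ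
  have hB' := fun s t (hst : s ≤ t) => norm_additive_sub_germ_le hq hq1 hκ hκc hΞ hJ hB hst
  rw [← constK_eq] at hB'
  refine ⟨J, hJ, fun s t _ ε hε => ?_, hB'⟩
  exact riemann_sums_tendsto (Ξ := fun s t => Y s (x t - x s)) hq hq1 hκ hκc hJ
    (constK_pos hp hp2).le hB' hε

variable [ProperSpace F]

lemma FinVar.exists_hasYoungIntegral (hp : 1 ≤ p) (hp2 : p < 2) (hY : FinVar p Y)
    (hx : FinVar p x) (hab : a ≤ b) : ∃ I, HasYoungIntegral Y x a b I := by
  obtain ⟨J, -, hJ, -⟩ := exists_youngIntegral hp hp2 hY hx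
  exact ⟨_, hJ a b hab⟩

lemma HasYoungIntegral.trans (hp : 1 ≤ p) (hp2 : p < 2) (hY : FinVar p Y)
    (hx : FinVar p x) (hab : a ≤ b) (hbc : b ≤ c) (h : HasYoungIntegral Y x a b I)
    (h' : HasYoungIntegral Y x b c I') : HasYoungIntegral Y x a c (I + I') := by
  obtain ⟨J, hadd, hJ, -⟩ := exists_youngIntegral hp hp2 hY hx
  rw [h.unique hab (hJ a b hab), h'.unique hbc (hJ b c hbc), ← hadd a b c hab hbc]
  exact hJ a c (hab.trans hbc)

lemma HasYoungIntegral.tail (hp : 1 ≤ p) (hp2 : p < 2) (hY : FinVar p Y)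
    (hx : FinVar p x) (hab : a ≤ b) (hbc : b ≤ c) (h : HasYoungIntegral Y x a b I)
    (h' : HasYoungIntegral Y x a c I') : HasYoungIntegral Y x b c (I' - I) := by
  obtain ⟨K, hK⟩ := hY.exists_hasYoungIntegral hp hp2 hx hbc
  rwa [h'.unique (hab.trans hbc) (h.trans hp hp2 hY hx hab hbc hK), add_sub_cancel_left]

lemma HasYoungIntegral.norm_sub_le (hp : 1 ≤ p) (hp2 : p < 2) (hY : FinVar p Y)
    (hx : FinVar p x) (hab : a ≤ b) (h : HasYoungIntegral Y x a b I) :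
    ‖I - Y a (x b - x a)‖ ≤ constK p * (pv p Y a b * pv p x a b) := by
  obtain ⟨J, -, hJ, hK⟩ := exists_youngIntegral hp hp2 hY hx
  rw [h.unique hab (hJ a b hab)]
  exact hK a b hab

lemma HasYoungIntegral.norm_le (hp : 1 ≤ p) (hp2 : p < 2) (hY : FinVar p Y)
    (hx : FinVar p x) (hab : a ≤ b) (h : HasYoungIntegral Y x a b I) :
    ‖I‖ ≤ (‖Y a‖ + constK p * pv p Y a b) * pv p x a b := by
  have h1 := h.norm_sub_le hp hp2 hY hx hab
  have h2 : ‖Y a (x b - x a)‖ ≤ ‖Y a‖ * pv p x a b :=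
    ((Y a).le_opNorm _).trans
      (mul_le_mul_of_nonneg_left (hx.norm_sub_le (by linarith) hab) (norm_nonneg _))
  have h3 := norm_le_norm_add_norm_sub' I (Y a (x b - x a))
  linarith

end YoungIntegral

/-! ### Solutions on an interval and their growth -/

section Solutions

variable {E F : Type*} [NormedAddCommGroup E] [NormedSpace ℝ E]
    [NormedAddCommGroup F] [NormedSpace ℝ F] {p : ℝ} {b : F → F}
    {g : F → E →L[ℝ] F} {x : ℝ → E} {y y' : ℝ → F} {s t u v : ℝ}

/-- `y` solves `dy = b y dt + g y dx` on `[s, t]`, in incremental form. -/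
structure SolOn (p : ℝ) (b : F → F) (g : F → E →L[ℝ] F) (x : ℝ → E) (s t : ℝ) (y : ℝ → F) :
    Prop where
  finVar : FinVar p y
  eqn : ∀ u v, s ≤ u → u ≤ v → v ≤ t →
    HasYoungIntegral (fun r => g (y r)) x u v (y v - y u - ∫ r in u..v, b (y r))

lemma SolOn.restrict (h : SolOn p b g x s t y) (hsu : s ≤ u) (hvt : v ≤ t) :
    SolOn p b g x u v y :=
  ⟨h.finVar, fun _ _ h1 h2 h3 => h.eqn _ _ (hsu.trans h1) h2 (h3.trans hvt)⟩

lemma SolOn.congr (h : SolOn p b g x s t y) (hy' : FinVar p y') (heq : EqOn y y' (Icc s t)) :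
    SolOn p b g x s t y' := by
  refine ⟨hy', fun u v hsu huv hvt => ?_⟩
  have hsub : Icc u v ⊆ Icc s t := Icc_subset_Icc hsu hvt
  have h1 : ∫ r in u..v, b (y' r) = ∫ r in u..v, b (y r) := by
    refine intervalIntegral.integral_congr fun r hr => ?_
    rw [uIcc_of_le huv] at hr
    simp only [heq (hsub hr)]
  rw [h1, ← heq (hsub (left_mem_Icc.2 huv)), ← heq (hsub (right_mem_Icc.2 huv))]
  exact (h.eqn u v hsu huv hvt).congr (fun r hr => by simp only [heq (hsub hr)])
    (fun _ _ => rfl)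

lemma SolOn.trans [ProperSpace F] (hp : 1 ≤ p) (hp2 : p < 2) (hx : FinVar p x) {Cg : ℝ≥0}
    (hg : LipschitzWith Cg g) (hb : Continuous b) (h : SolOn p b g x s u y)
    (h' : SolOn p b g x u t y) : SolOn p b g x s t y := by
  refine ⟨h.finVar, fun v w hv hvw hw => ?_⟩
  rcases le_total w u with h1 | h1
  · exact h.eqn v w hv hvw h1
  rcases le_total u v with h2 | h2
  · exact h'.eqn v w h2 hvw hw
  have hI : ∀ a c, IntervalIntegrable (fun r => b (y r)) MeasureTheory.volume a c := fun a c =>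
    (hb.comp h.finVar.cont).intervalIntegrable a c
  have h3 := (h.eqn v u hv h2 le_rfl).trans hp hp2 (h.finVar.lipschitz (by linarith) hg) hx h2 h1
    (h'.eqn u w le_rfl h1 hw)
  convert h3 using 1
  rw [← intervalIntegral.integral_add_adjacent_intervals (hI v u) (hI u w)]
  abel

lemma SolOn.glue [ProperSpace F] (hp : 1 ≤ p) (hp2 : p < 2) (hx : FinVar p x) {Cg : ℝ≥0}
    (hg : LipschitzWith Cg g) (hb : Continuous b) (hsu : s ≤ u) (h : SolOn p b g x s u y)
    (h' : SolOn p b g x u t y') (hy : y u = y' u) :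
    ∃ z, SolOn p b g x s t z ∧ z s = y s := by
  have hp0 : 0 < p := by linarith
  have h1 := h.finVar.comp hp0 (c := fun r => min r u)
    (fun _ _ h => min_le_min_right u h) (by fun_prop)
  have h2 := h'.finVar.comp hp0 (c := fun r => max r u)
    (fun _ _ h => max_le_max_right u h) (by fun_prop)
  -- The glued path is `y (min r u) + y' (max r u) - y u`; in this form its finite variation is
  -- immediate.
  have h3 := (h1.add hp h2).sub hp (finVar_const hp (y u))
  refine ⟨_, SolOn.trans (u := u) hp hp2 hx hg hb (h.congr h3 fun r hr => ?_)
    (h'.congr h3 fun r hr => ?_), ?_⟩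
  · simp [hr.2, hy]
  · simp [hr.1]
  · simp [hsu, hy]

lemma monotone_primitive {h : ℝ → ℝ} (hh : Continuous h) (h0 : ∀ r, 0 ≤ h r) :
    Monotone fun r => ∫ q in (0 : ℝ)..r, h q := by
  intro u v huv
  have h1 := intervalIntegral.integral_interval_sub_left (hh.intervalIntegrable 0 v)
    (hh.intervalIntegrable (μ := MeasureTheory.volume) 0 u)
  have h2 := intervalIntegral.integral_nonneg (μ := MeasureTheory.volume) huv fun r _ => h0 r
  simp only
  linarith

lemma isCtl_integral (hp : 1 ≤ p) {h : ℝ → ℝ} (hh : Continuous h) (h0 : ∀ r, 0 ≤ h r) :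
    IsCtl p fun u v => ∫ q in u..v, h q := by
  convert! IsCtl.of_monotone hp (monotone_primitive hh h0) using 3 with u v
  exact (intervalIntegral.integral_interval_sub_left (hh.intervalIntegrable 0 _)
    (hh.intervalIntegrable (μ := MeasureTheory.volume) 0 _)).symm

/-- A Gronwall inequality in integral form. -/
lemma gronwall_integral {h : ℝ → ℝ} (hh : Continuous h) {L c C : ℝ} (hL : 0 < L)
    (hbound : ∀ v ∈ Icc s t, h v ≤ C + 2 * ∫ r in s..v, (L * h r + c))
    (hh0 : ∀ r, 0 ≤ h r) (hc : 0 ≤ c) (hst : s ≤ t) :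
    C + 2 * ∫ r in s..t, (L * h r + c) ≤
      (C + c / L) * Real.exp (2 * L * (t - s)) - c / L := by
  have hcont : Continuous fun r => L * h r + c := by fun_prop
  set H : ℝ → ℝ := fun v => C + 2 * ∫ r in s..v, (L * h r + c) with hH
  have hd : ∀ v, HasDerivAt H (2 * (L * h v + c)) v := fun v =>
    ((intervalIntegral.integral_hasDerivAt_right (hcont.intervalIntegrable _ _)
      (hcont.stronglyMeasurableAtFilter _ _) hcont.continuousAt).const_mul
      2).const_add C
  -- Since `h ≤ H` on `[s, t]`, the derivative of `H` is at most `2 * L * H + 2 * c`, and the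
  -- differential Gronwall inequality applies to `H`.
  have hnn : ∀ v ∈ Icc s t, 0 ≤ H v := fun v hv => (hh0 v).trans (hbound v hv)
  have h1 := norm_le_gronwallBound_of_norm_deriv_right_le (f := H)
    (f' := fun v => 2 * (L * h v + c)) (δ := C) (K := 2 * L) (ε := 2 * c) (a := s) (b := t)
    (fun v _ => (hd v).continuousAt.continuousWithinAt)
    (fun v _ => (hd v).hasDerivWithinAt)
    (by
      have := hnn s (left_mem_Icc.2 hst)
      rw [Real.norm_of_nonneg this]
      simp [hH])
    (fun v hv => by
      have h2 := hnn v (Ico_subset_Icc_self hv)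
      have h3 := hbound v (Ico_subset_Icc_self hv)
      have h4 := hh0 v
      rw [Real.norm_of_nonneg (by positivity), Real.norm_of_nonneg h2]
      have : L * h v ≤ L * H v := mul_le_mul_of_nonneg_left h3 hL.le
      linarith) t (right_mem_Icc.2 hst)
  rw [Real.norm_of_nonneg (hnn t (right_mem_Icc.2 hst)), gronwallBound_of_K_ne_0 (by positivity)]
    at h1
  refine h1.trans (le_of_eq ?_)
  field_simp
  ring

variable [ProperSpace F]

lemma norm_le_affine_of_lipschitz {X Z : Type*} [NormedAddCommGroup X] [NormedAddCommGroup Z]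
    {C : ℝ≥0} {f : X → Z} (hf : LipschitzWith C f) (z : X) : ‖f z‖ ≤ ‖f 0‖ + C * ‖z‖ := by
  have h1 := hf.norm_sub_le z 0
  have h2 := norm_le_norm_add_norm_sub' (f z) (f 0)
  rw [sub_zero] at h1
  linarith

/-- The threshold `γ` is chosen so that the variation of `y` enters its own bound with the factor `1
/ 2`. After absorption the initial value carries `1 + 1 / (K + 1) = e^α`. -/
lemma SolOn.norm_add_pv_le_of_small (hp : 1 ≤ p) (hp2 : p < 2) (hx : FinVar p x) {Cg : ℝ≥0}
    (hg : LipschitzWith Cg g) (hCg : 0 < Cg) {L b₀ : ℝ} (hL : 0 < L)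
    (hb₀ : 0 ≤ b₀) (hbL : ∀ z, ‖b z‖ ≤ L * ‖z‖ + b₀) (hst : s ≤ t)
    (hxs : pv p x s t ≤ constGamma p Cg) (h : SolOn p b g x s t y) :
    ‖y s‖ + pv p y s t ≤
      (Real.exp (constAlpha p) * ‖y s‖ + constM0 p L Cg b₀ ‖g 0‖) *
        Real.exp (2 * L * (t - s)) := by
  have hp0 : 0 < p := by linarith
  have hK := constK_pos hp hp2
  have hy := h.finVar
  have hgy := hy.lipschitz hp0 hg
  have hCg' : (0 : ℝ) < Cg := by exact_mod_cast hCg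
  set K := constK p with hKdef
  set γ := constGamma p Cg with hγ
  have hγ0 : 0 ≤ γ := pv_nonneg.trans hxs
  have hγ1 : γ * ((K + 1) * Cg) = 1 / 2 := by
    rw [hγ, constGamma, ← hKdef]; field_simp
  have hγ2 : 2 * (γ * Cg) = 1 / (K + 1) := by
    rw [hγ, constGamma, ← hKdef]; field_simp
  have hγ3 : 2 * (γ * ‖g 0‖) = ‖g 0‖ / ((K + 1) * Cg) := by
    rw [hγ, constGamma, ← hKdef]; field_simp
  have hα : Real.exp (constAlpha p) = 1 + 1 / (K + 1) := by
    rw [constAlpha, ← hKdef, Real.exp_log (by positivity)]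
  have hcont : Continuous fun r => L * ‖y r‖ + b₀ := by have := hy.cont; fun_prop
  have hnn : ∀ r, 0 ≤ L * ‖y r‖ + b₀ := fun r => by positivity
  have hkey : ∀ v ∈ Icc s t, ‖y s‖ + pv p y s v ≤
      ((1 + 1 / (K + 1)) * ‖y s‖ + ‖g 0‖ / ((K + 1) * Cg)) +
        2 * ∫ r in s..v, (L * ‖y r‖ + b₀) := by
    intro v hv
    set D := pv p y s v with hD
    have hD0 : 0 ≤ D := pv_nonneg
    -- A bound for `‖g (y u)‖ + K * pv p (g ∘ y) u w`, uniform over subintervals of `[s, v]`: one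
    -- `Cg * D` comes from the size of `y u`, and `K * Cg * D` from the Young–Loève term.
    set c := ‖g 0‖ + Cg * ‖y s‖ + (K + 1) * Cg * D with hc
    have hc0 : 0 ≤ c := by positivity
    have hctl := (isCtl_integral hp hcont hnn).add hp ((hx.isCtl hp0).smul hc0)
    have hle := pv_le_of_ctl (x := y) hp0 hctl hv.1 fun u w hsu huw hwv => by
      have e1 := (h.eqn u w hsu huw (hwv.trans hv.2)).norm_le hp hp2 hgy hx huw
      have e2 : ‖∫ r in u..w, b (y r)‖ ≤ ∫ r in u..w, (L * ‖y r‖ + b₀) :=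
        intervalIntegral.norm_integral_le_of_norm_le huw
          (Eventually.of_forall fun r _ => hbL (y r)) (hcont.intervalIntegrable _ _)
      have e3 : pv p (fun r => g (y r)) u w ≤ Cg * D :=
        (hy.pv_lipschitz_le hp0 hg huw).trans
          (mul_le_mul_of_nonneg_left (hy.mono hp0 hsu hwv) Cg.2)
      have e4 : ‖y u‖ ≤ ‖y s‖ + D := by
        have i1 := norm_le_norm_add_norm_sub' (y u) (y s)
        have i2 := (hy.norm_sub_le hp0 hsu).trans (hy.mono hp0 le_rfl (huw.trans hwv))
        linarith
      have e5 : ‖g (y u)‖ + K * pv p (fun r => g (y r)) u w ≤ c := by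
        have i1 := norm_le_affine_of_lipschitz hg (y u)
        have i2 := mul_le_mul_of_nonneg_left e4 hCg'.le
        have i3 := mul_le_mul_of_nonneg_left e3 hK.le
        rw [hc]
        linarith
      have e6 := mul_le_mul_of_nonneg_right e5 (pv_nonneg (p := p) (x := x) (a := u) (b := w))
      have e7 : y w - y u = (y w - y u - ∫ r in u..w, b (y r)) + ∫ r in u..w, b (y r) := by abel
      rw [e7]
      refine (norm_add_le _ _).trans ?_
      linarith
    have hxv : pv p x s v ≤ γ := (hx.mono hp0 le_rfl hv.2).trans hxs
    have h1 := mul_le_mul_of_nonneg_left hxv hc0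
    have h2 : c * γ = γ * ‖g 0‖ + γ * Cg * ‖y s‖ + (γ * ((K + 1) * Cg)) * D := by
      rw [hc]; ring
    -- Now `D ≤ ∫ + γ * ‖g 0‖ + γ * Cg * ‖y s‖ + D / 2`, and half of `D` moves to the left.
    rw [hγ1] at h2
    have h3 : (1 + 1 / (K + 1)) * ‖y s‖ + ‖g 0‖ / ((K + 1) * Cg) =
        ‖y s‖ + 2 * (γ * Cg) * ‖y s‖ + 2 * (γ * ‖g 0‖) := by
      rw [hγ2, hγ3]; ring
    rw [h3]
    linarith
  have hgr := gronwall_integral (h := fun r => ‖y r‖) hy.cont.norm (s := s) (t := t) hL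
    (fun v hv => (le_trans (by
      have i1 := norm_le_norm_add_norm_sub' (y v) (y s)
      have i2 := hy.norm_sub_le hp0 hv.1
      linarith) (hkey v hv))) (fun r => norm_nonneg _) hb₀ hst
  have h1 := (hkey t (right_mem_Icc.2 hst)).trans hgr
  have h2 : 0 ≤ b₀ / L := by positivity
  rw [hα, constM0, ← hKdef]
  refine h1.trans ((sub_le_self _ h2).trans (le_of_eq ?_))
  ring

/-- With `B n = ‖y (τ 0)‖ + pv p y (τ 0) (τ n)`, subadditivity of the variation and `‖y (τ n)‖ ≤ B
n` give `B (n + 1) ≤ e^α Δ B n + M₀ Δ`, where `Δ` is the Gronwall factor of the step. No power of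
`n` is lost. -/
lemma SolOn.norm_add_pv_le (hp : 1 ≤ p) (hp2 : p < 2) (hx : FinVar p x) {Cg : ℝ≥0}
    (hg : LipschitzWith Cg g) (hCg : 0 < Cg) {L b₀ : ℝ} (hL : 0 < L)
    (hb₀ : 0 ≤ b₀) (hbL : ∀ z, ‖b z‖ ≤ L * ‖z‖ + b₀) {τ : ℕ → ℝ} :
    ∀ n : ℕ, (∀ k < n, τ k ≤ τ (k + 1)) → (∀ k < n, pv p x (τ k) (τ (k + 1)) ≤ constGamma p Cg) →
      SolOn p b g x (τ 0) (τ n) y →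
      ‖y (τ 0)‖ + pv p y (τ 0) (τ n) ≤ (‖y (τ 0)‖ + constM0 p L Cg b₀ ‖g 0‖ * n) *
        Real.exp (constAlpha p * n + 2 * L * (τ n - τ 0)) := by
  have hp0 : 0 < p := by linarith
  have hK := constK_pos hp hp2
  have hα0 : 0 ≤ constAlpha p := Real.log_nonneg (by
    have : 0 < 1 / (constK p + 1) := by positivity
    linarith)
  have hM0 : 0 ≤ constM0 p L Cg b₀ ‖g 0‖ := by unfold constM0; positivity
  set M := constM0 p L Cg b₀ ‖g 0‖
  set α := constAlpha p
  intro n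
  induction n with
  | zero =>
    intro _ _ h
    simp [h.finVar.pv_self hp0]
  | succ n ih =>
    intro hτ hγ h
    have hle : τ n ≤ τ (n + 1) := hτ n (by omega)
    have h0n : τ 0 ≤ τ n := by
      have : IsPartition (τ 0) (τ n) n τ := ⟨rfl, rfl, fun i hi => hτ i (by omega)⟩
      exact this.le
    have i1 := ih (fun k hk => hτ k (by omega)) (fun k hk => hγ k (by omega))
      (h.restrict le_rfl hle)
    have i2 := (h.restrict h0n le_rfl).norm_add_pv_le_of_small hp hp2 hx hg hCg hL hb₀ hbL hle
      (hγ n (by omega))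
    have i3 := h.finVar.pv_add_le hp h0n hle
    have i4 : ‖y (τ n)‖ ≤ ‖y (τ 0)‖ + pv p y (τ 0) (τ n) := by
      have j1 := norm_le_norm_add_norm_sub' (y (τ n)) (y (τ 0))
      have j2 := h.finVar.norm_sub_le hp0 h0n
      linarith
    set A := ‖y (τ 0)‖
    set B := A + pv p y (τ 0) (τ n)
    set e := Real.exp α with he
    set Δ := Real.exp (2 * L * (τ (n + 1) - τ n)) with hΔ
    set X := Real.exp (α * n + 2 * L * (τ n - τ 0)) with hX
    have hX' : Real.exp (α * ((n + 1 : ℕ) : ℝ) + 2 * L * (τ (n + 1) - τ 0)) = X * e * Δ := by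
      rw [he, hΔ, hX, ← Real.exp_add, ← Real.exp_add]
      congr 1
      push_cast
      ring
    have he1 : 1 ≤ e := Real.one_le_exp hα0
    have hΔ1 : 1 ≤ Δ := Real.one_le_exp (mul_nonneg (by positivity) (by linarith))
    have hX1 : 1 ≤ X := Real.one_le_exp (add_nonneg (by positivity)
      (mul_nonneg (by positivity) (by linarith)))
    have heΔ : 1 ≤ e * Δ := by nlinarith
    have hXe : 1 ≤ X * e := by nlinarith
    rw [hX']
    push_cast
    calc A + pv p y (τ 0) (τ (n + 1))
        ≤ B + (e * Δ - 1) * ‖y (τ n)‖ + M * Δ := by linarith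
      _ ≤ B + (e * Δ - 1) * B + M * Δ := by
          have := mul_le_mul_of_nonneg_left i4 (sub_nonneg.2 heΔ)
          linarith
      _ = B * (e * Δ) + M * Δ := by ring
      _ ≤ ((A + M * n) * X) * (e * Δ) + (X * e) * (M * Δ) := by
          have j1 := mul_le_mul_of_nonneg_right i1 (show 0 ≤ e * Δ by linarith)
          have j2 := mul_le_mul_of_nonneg_right hXe (show 0 ≤ M * Δ by positivity)
          linarith
      _ = _ := by ring

end Solutions

/-! ### The four-point estimate for a map with Lipschitz derivative -/

section FourPoint

variable {X Z : Type*} [NormedAddCommGroup X] [NormedSpace ℝ X]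
    [NormedAddCommGroup Z] [NormedSpace ℝ Z]

/-- The difference of `g` along the segments from `b` to `a` and from `d` to `c` is a function of `θ
∈ [0, 1]`. The mean value inequality applies to it, and the two points at parameter `θ` differ by a
convex combination of `a - c` and `b - d`. -/
lemma norm_four_point_le {g : X → Z} {Cg C' : ℝ≥0} (hg : LipschitzWith Cg g)
    (hg1 : Differentiable ℝ g) (hg2 : LipschitzWith C' (fderiv ℝ g)) (a b c d : X) :
    ‖g a - g b - (g c - g d)‖ ≤
      Cg * ‖a - b - (c - d)‖ + C' * (‖a - c‖ + ‖b - d‖) * ‖c - d‖ := by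
  set φ : ℝ → Z := fun θ => g (b + θ • (a - b)) - g (d + θ • (c - d)) with hφ
  have hline : ∀ (u v : X) (θ : ℝ), HasDerivAt (fun θ : ℝ => u + θ • v) v θ := fun u v θ => by
    simpa using ((hasDerivAt_id θ).smul_const v).const_add u
  have hd : ∀ θ, HasDerivAt φ (fderiv ℝ g (b + θ • (a - b)) (a - b) -
      fderiv ℝ g (d + θ • (c - d)) (c - d)) θ := fun θ =>
    ((hg1 _).hasFDerivAt.comp_hasDerivAt θ (hline b (a - b) θ)).sub
      ((hg1 _).hasFDerivAt.comp_hasDerivAt θ (hline d (c - d) θ))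
  have h := norm_image_sub_le_of_norm_deriv_le_segment_01' (f := φ)
    (fun θ _ => (hd θ).hasDerivWithinAt) (C := Cg * ‖a - b - (c - d)‖ +
      C' * (‖a - c‖ + ‖b - d‖) * ‖c - d‖) (fun θ hθ => ?_)
  · rw [sub_sub_sub_comm]
    simpa [hφ] using h
  have e : fderiv ℝ g (b + θ • (a - b)) (a - b) - fderiv ℝ g (d + θ • (c - d)) (c - d) =
      fderiv ℝ g (b + θ • (a - b)) (a - b - (c - d)) +
        (fderiv ℝ g (b + θ • (a - b)) - fderiv ℝ g (d + θ • (c - d))) (c - d) := by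
    rw [map_sub (fderiv ℝ g (b + θ • (a - b))) (a - b) (c - d), sub_apply]
    abel
  rw [e]
  refine (norm_add_le _ _).trans (add_le_add ?_ ?_)
  · exact ((fderiv ℝ g _).le_opNorm _).trans
      (mul_le_mul_of_nonneg_right (norm_fderiv_le_of_lipschitz ℝ hg) (norm_nonneg _))
  · refine (ContinuousLinearMap.le_opNorm _ _).trans
      (mul_le_mul_of_nonneg_right ?_ (norm_nonneg _))
    refine (hg2.norm_sub_le _ _).trans (mul_le_mul_of_nonneg_left ?_ C'.2)
    have e2 : b + θ • (a - b) - (d + θ • (c - d)) = θ • (a - c) + (1 - θ) • (b - d) := by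
      module
    rw [e2]
    refine (norm_add_le _ _).trans (add_le_add ?_ ?_)
    · rw [norm_smul, Real.norm_of_nonneg hθ.1]
      exact mul_le_of_le_one_left (norm_nonneg _) hθ.2.le
    · rw [norm_smul, Real.norm_of_nonneg (by linarith [hθ.2])]
      exact mul_le_of_le_one_left (norm_nonneg _) (by linarith [hθ.1])

end FourPoint

/-! ### The Lipschitz estimate for the Picard map, and uniqueness -/

section WellPosed

variable {E F : Type*} [NormedAddCommGroup E] [NormedSpace ℝ E]
    [NormedAddCommGroup F] [NormedSpace ℝ F] [ProperSpace F] {p : ℝ} {b : F → F}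
    {g : F → E →L[ℝ] F} {x : ℝ → E} {y z P : ℝ → F} {s t v : ℝ} {Lb Cg C' : ℝ≥0}

/-- The solution map is Lipschitz for the variation seminorm. -/
lemma pv_picard_sub_le (hp : 1 ≤ p) (hp2 : p < 2) (hx : FinVar p x)
    (hb : LipschitzWith Lb b) (hg : LipschitzWith Cg g) (hg1 : Differentiable ℝ g)
    (hg2 : LipschitzWith C' (fderiv ℝ g)) (hy : FinVar p y) (hz : FinVar p z) (hyz : y s = z s)
    (hsv : s ≤ v)
    (hP : ∀ u w, s ≤ u → u ≤ w → w ≤ v →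
      HasYoungIntegral (fun r => g (y r) - g (z r)) x u w
        (P w - P u - ∫ r in u..w, (b (y r) - b (z r)))) :
    pv p P s v ≤ (Lb * (v - s) + (Cg + constK p * (Cg + C' * (pv p y s v + pv p z s v))) *
      pv p x s v) * pv p (fun r => y r - z r) s v := by
  have hp0 : 0 < p := by linarith
  have hK := constK_pos hp hp2
  have hyz' := hy.sub hp hz
  have hW := (hy.lipschitz hp0 hg).sub hp (hz.lipschitz hp0 hg)
  set K := constK p
  set D := pv p (fun r => y r - z r) s v with hD
  set R := pv p y s v + pv p z s v with hR
  have hD0 : 0 ≤ D := pv_nonneg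
  have hR0 : 0 ≤ R := add_nonneg pv_nonneg pv_nonneg
  have hdist : ∀ u, s ≤ u → u ≤ v → ‖y u - z u‖ ≤ D := fun u hsu huv => by
    have h1 := (hyz'.norm_sub_le hp0 hsu).trans (hyz'.mono hp0 le_rfl huv)
    simpa [hyz] using h1
  -- The four-point estimate bounds each increment by a control; the factor `‖y u - z u‖` is at most
  -- `D` because the two paths agree at `s`.
  have hWpv : pv p (fun r => g (y r) - g (z r)) s v ≤ Cg * D + C' * D * R := by
    refine pv_le_of_ctl (κ := fun u w => Cg * pv p (fun r => y r - z r) u w +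
      C' * D * (pv p y u w + pv p z u w)) hp0 (((hyz'.isCtl hp0).smul Cg.2).add hp
      (((hy.isCtl hp0).add hp (hz.isCtl hp0)).smul (mul_nonneg C'.2 hD0))) hsv
      fun u w hsu huw hwv => ?_
    have h1 := norm_four_point_le hg hg1 hg2 (y w) (z w) (y u) (z u)
    refine h1.trans (add_le_add
      (mul_le_mul_of_nonneg_left (hyz'.norm_sub_le hp0 huw) Cg.2) ?_)
    have h2 := add_le_add (hy.norm_sub_le hp0 huw) (hz.norm_sub_le hp0 huw)
    have h3 := hdist u hsu (huw.trans hwv)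
    calc (C' : ℝ) * (‖y w - y u‖ + ‖z w - z u‖) * ‖y u - z u‖
        ≤ C' * (pv p y u w + pv p z u w) * D :=
          mul_le_mul (mul_le_mul_of_nonneg_left h2 C'.2) h3 (norm_nonneg _)
            (mul_nonneg C'.2 (add_nonneg pv_nonneg pv_nonneg))
      _ = _ := by ring
  have hcont : Continuous fun r => b (y r) - b (z r) :=
    (hb.continuous.comp hy.cont).sub (hb.continuous.comp hz.cont)
  set c := (Cg + K * (Cg + C' * R)) * D with hc
  have hc0 : 0 ≤ c := by positivity
  have hmono : Monotone fun r : ℝ => Lb * D * r := fun r q h =>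
    mul_le_mul_of_nonneg_left h (by positivity)
  have hmain := pv_le_of_ctl (x := P) hp0
    ((IsCtl.of_monotone hp hmono).add hp ((hx.isCtl hp0).smul hc0)) hsv
    fun u w hsu huw hwv => by
      have h1 := (hP u w hsu huw hwv).norm_le hp hp2 hW hx huw
      have h2 : ‖∫ r in u..w, (b (y r) - b (z r))‖ ≤ Lb * D * |w - u| :=
        intervalIntegral.norm_integral_le_of_norm_le_const fun r hr => by
          rw [uIoc_of_le huw] at hr
          exact (hb.norm_sub_le _ _).trans (mul_le_mul_of_nonneg_left
            (hdist r (hsu.trans hr.1.le) (hr.2.trans hwv)) Lb.2)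
      rw [abs_of_nonneg (sub_nonneg.2 huw)] at h2
      have h3 : ‖g (y u) - g (z u)‖ ≤ Cg * D := (hg.norm_sub_le _ _).trans
        (mul_le_mul_of_nonneg_left (hdist u hsu (huw.trans hwv)) Cg.2)
      have h4 : ‖g (y u) - g (z u)‖ + K * pv p (fun r => g (y r) - g (z r)) u w ≤ c := by
        have h5 := mul_le_mul_of_nonneg_left ((hW.mono hp0 hsu hwv).trans hWpv) hK.le
        have h6 : c = Cg * D + K * (Cg * D + C' * D * R) := by rw [hc]; ring
        linarith
      have h5 := mul_le_mul_of_nonneg_right h4 (pv_nonneg (p := p) (x := x) (a := u) (b := w))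
      have h6 : P w - P u = (P w - P u - ∫ r in u..w, (b (y r) - b (z r))) +
          ∫ r in u..w, (b (y r) - b (z r)) := by abel
      rw [h6]
      refine (norm_add_le _ _).trans ?_
      linarith
  refine hmain.trans (le_of_eq ?_)
  rw [hc]
  ring

lemma SolOn.eqOn (hp : 1 ≤ p) (hp2 : p < 2) (hx : FinVar p x)
    (hb : LipschitzWith Lb b) (hg : LipschitzWith Cg g) (hg1 : Differentiable ℝ g)
    (hg2 : LipschitzWith C' (fderiv ℝ g)) (hy : SolOn p b g x s t y) (hz : SolOn p b g x s t z)
    (hyz : y s = z s) : EqOn y z (Icc s t) := by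
  have hp0 : 0 < p := by linarith
  have hK := constK_pos hp hp2
  set R := pv p y s t + pv p z s t with hR
  have hR0 : 0 ≤ R := add_nonneg pv_nonneg pv_nonneg
  set c := Cg + constK p * (Cg + C' * R) with hc
  have hc0 : 0 ≤ c := by positivity
  obtain ⟨δ₁, hδ₁, hsmall⟩ := hx.exists_small hp s t (ε := 1 / (4 * (c + 1))) (by positivity)
  set δ := min (δ₁ / 2) (1 / (4 * (Lb + 1))) with hδ
  have hδ0 : 0 < δ := lt_min (by positivity) (by positivity)
  have hstep : ∀ u v, s ≤ u → u ≤ v → v ≤ t → v - u ≤ δ → y u = z u → EqOn y z (Icc u v) := by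
    intro u v hsu huv hvt hd heq
    have hcont : ∀ {q : ℝ → F}, SolOn p b g x s t q → ∀ a c, IntervalIntegrable
        (fun r => b (q r)) MeasureTheory.volume a c := fun hq a c =>
      (hb.continuous.comp hq.finVar.cont).intervalIntegrable a c
    -- The difference of two solutions is its own Picard image, so `D` is bounded by a factor times
    -- `D`; on short intervals that factor is at most `1 / 4 + 1 / 4`, which forces `D = 0`.
    have h1 := pv_picard_sub_le (P := fun r => y r - z r) hp hp2 hx hb hg hg1 hg2 hy.finVar
      hz.finVar heq huv fun q w huq hqw hwv => by
        convert (hy.eqn q w (hsu.trans huq) hqw (hwv.trans hvt)).sub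
          (hz.eqn q w (hsu.trans huq) hqw (hwv.trans hvt)) using 1
        rw [intervalIntegral.integral_sub (hcont hy _ _) (hcont hz _ _)]
        abel
    set D := pv p (fun r => y r - z r) u v
    have hD0 : 0 ≤ D := pv_nonneg
    have h2 : Lb * (v - u) ≤ 1 / 4 := by
      have i1 : v - u ≤ 1 / (4 * (Lb + 1)) := hd.trans (min_le_right _ _)
      calc (Lb : ℝ) * (v - u) ≤ (Lb + 1) * (1 / (4 * (Lb + 1))) := by
            refine mul_le_mul (by linarith) i1 (by linarith) (by positivity)
        _ = 1 / 4 := by field_simp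
    have h3 : (Cg + constK p * (Cg + C' * (pv p y u v + pv p z u v))) * pv p x u v ≤ 1 / 4 := by
      have i1 : pv p x u v ≤ 1 / (4 * (c + 1)) := (hsmall u v hsu huv hvt
        (by have := hd.trans (min_le_left _ _); linarith)).le
      have i2 : pv p y u v + pv p z u v ≤ R :=
        add_le_add (hy.finVar.mono hp0 hsu hvt) (hz.finVar.mono hp0 hsu hvt)
      have i3 : Cg + constK p * (Cg + C' * (pv p y u v + pv p z u v)) ≤ c + 1 := by
        have : constK p * (Cg + C' * (pv p y u v + pv p z u v)) ≤
            constK p * (Cg + C' * R) := by gcongr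
        rw [hc]; linarith
      calc _ ≤ (c + 1) * (1 / (4 * (c + 1))) :=
            mul_le_mul i3 i1 pv_nonneg (by positivity)
        _ = 1 / 4 := by field_simp
    have h4 : D = 0 := by nlinarith
    intro r hr
    have hyz' := hy.finVar.sub hp hz.finVar
    have h5 := (hyz'.norm_sub_le hp0 hr.1).trans (hyz'.mono hp0 le_rfl hr.2)
    have h6 : ‖y r - z r‖ ≤ 0 := by simpa [heq, D, h4] using h5.trans h4.le
    exact sub_eq_zero.1 (norm_le_zero_iff.1 h6)
  intro r hr
  have hst : s ≤ t := hr.1.trans hr.2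
  have hall : ∀ n : ℕ, EqOn y z (Icc s (min (s + n * δ) t)) := by
    intro n
    induction n with
    | zero =>
      intro q hq
      have h1 : q = s := le_antisymm (by have := hq.2.trans (min_le_left _ _); simpa using this) hq.1
      rw [h1, hyz]
    | succ n ih =>
      set u := min (s + n * δ) t with hu
      set v := min (s + (n + 1 : ℕ) * δ) t with hv
      have hsu : s ≤ u := le_min (by have : 0 ≤ n * δ := by positivity
                                     linarith) hst
      have h1 : s + (n + 1 : ℕ) * δ = s + n * δ + δ := by push_cast; ring
      have huv : u ≤ v := min_le_min_right t (by linarith)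
      have hd : v - u ≤ δ := by
        have : v ≤ u + δ := by
          rw [hu, hv, h1, ← min_add_add_right]
          exact le_min (min_le_left _ _) ((min_le_right _ _).trans (by linarith))
        linarith
      intro q hq
      rcases le_total q u with h | h
      · exact ih ⟨hq.1, h⟩
      · exact hstep u v hsu huv (min_le_right _ _) hd (ih ⟨hsu, le_rfl⟩) ⟨h, hq.2⟩
  obtain ⟨n, hn⟩ := exists_nat_ge ((t - s) / δ)
  rw [div_le_iff₀ hδ0] at hn
  exact hall n ⟨hr.1, le_min (by linarith [hr.2]) hr.2⟩

end WellPosed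

/-! ### Picard iteration and global existence -/

section Existence

variable {E F : Type*} [NormedAddCommGroup E] [NormedAddCommGroup F] {p : ℝ} {x : ℝ → E}
    {y P : ℝ → F} {s t : ℝ}

lemma continuous_of_norm_sub_le_pv (hp : 1 ≤ p) (hx : FinVar p x) {M₁ M₂ : ℝ}
    (h₁ : 0 ≤ M₁) (h₂ : 0 ≤ M₂)
    (h : ∀ u w, u ≤ w → ‖P w - P u‖ ≤ M₁ * (w - u) + M₂ * pv p x u w) : Continuous P := by
  rw [Metric.continuous_iff]
  intro t ε hε
  obtain ⟨δ₁, hδ₁, hs⟩ := hx.exists_small hp (t - 1) (t + 1) (ε := ε / (2 * (M₂ + 1)))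
    (by positivity)
  have key : ∀ u w, t - 1 ≤ u → u ≤ w → w ≤ t + 1 →
      w - u < min δ₁ (ε / (2 * (M₁ + 1))) → ‖P w - P u‖ < ε := by
    intro u w hu huw hw hd
    have i1 := hs u w hu huw hw (hd.trans_le (min_le_left _ _))
    have i2 := hd.trans_le (min_le_right _ _)
    have i0 : 0 ≤ pv p x u w := pv_nonneg
    rw [lt_div_iff₀ (by positivity)] at i1 i2
    have i3 := h u w huw
    nlinarith
  refine ⟨min (min δ₁ (ε / (2 * (M₁ + 1)))) 1, lt_min (lt_min hδ₁ (by positivity)) one_pos,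
    fun r hr => ?_⟩
  rw [Real.dist_eq, abs_lt, neg_lt] at hr
  have hr1 := hr.1.trans_le (min_le_left _ _)
  have hr2 := hr.2.trans_le (min_le_left _ _)
  have hr3 := hr.1.trans_le (min_le_right _ _)
  have hr4 := hr.2.trans_le (min_le_right _ _)
  rcases le_total r t with hrt | hrt
  · rw [dist_comm, dist_eq_norm]
    exact key r t (by linarith) hrt (by linarith) (by linarith)
  · rw [dist_eq_norm]
    exact key t r (by linarith) hrt (by linarith) (by linarith)

/-- The paths on which Picard's iteration runs: they start in `ξ`, have variation at most one on
`[s, t]` and are constant outside `[s, t]`. -/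
structure IsPicardPath (p : ℝ) (s t : ℝ) (ξ : F) (y : ℝ → F) : Prop where
  finVar : FinVar p y
  init : y s = ξ
  pv_le : pv p y s t ≤ 1
  eq_clamp : ∀ r, y r = y (max s (min r t))

lemma monotone_clamp (s t : ℝ) : Monotone fun r => max s (min r t) := fun _ _ h =>
  max_le_max le_rfl (min_le_min_right t h)

lemma clamp_mem (hst : s ≤ t) (r : ℝ) : max s (min r t) ∈ Icc s t :=
  ⟨le_max_left _ _, max_le hst (min_le_right _ _)⟩

lemma clamp_of_mem {r : ℝ} (hr : r ∈ Icc s t) : max s (min r t) = r := by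
  rw [min_eq_left hr.2, max_eq_right hr.1]

lemma IsPicardPath.norm_le (hp : 1 ≤ p) (hst : s ≤ t) {ξ : F} (h : IsPicardPath p s t ξ y)
    (r : ℝ) : ‖y r‖ ≤ ‖ξ‖ + 1 := by
  have hp0 : 0 < p := by linarith
  rw [h.eq_clamp r]
  have h1 := clamp_mem hst r
  have h2 := (h.finVar.norm_sub_le hp0 h1.1).trans
    ((h.finVar.mono hp0 le_rfl h1.2).trans h.pv_le)
  have h3 := norm_le_norm_add_norm_sub' (y (max s (min r t))) (y s)
  rw [h.init] at h2 h3
  linarith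

variable [NormedSpace ℝ E] [NormedSpace ℝ F] [ProperSpace F] {b : F → F} {g : F → E →L[ℝ] F}
    {Lb Cg C' : ℝ≥0}

/-- Picard's map preserves the Picard paths on short intervals. -/
lemma IsPicardPath.exists_image (hp : 1 ≤ p) (hp2 : p < 2) (hx : FinVar p x)
    (hb : LipschitzWith Lb b) (hg : LipschitzWith Cg g) (hst : s ≤ t) {ξ : F}
    (hsmall : (‖b 0‖ + Lb * (‖ξ‖ + 1)) * (t - s) +
      (‖g 0‖ + Cg * (‖ξ‖ + 1) + constK p * Cg) * pv p x s t ≤ 1)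
    (h : IsPicardPath p s t ξ y) :
    ∃ P, IsPicardPath p s t ξ P ∧ ∀ u w, s ≤ u → u ≤ w → w ≤ t →
      HasYoungIntegral (fun r => g (y r)) x u w (P w - P u - ∫ r in u..w, b (y r)) := by
  have hp0 : 0 < p := by linarith
  have hK := constK_pos hp hp2
  have hgy := h.finVar.lipschitz hp0 hg
  obtain ⟨J, hadd, hJ, -⟩ := exists_youngIntegral hp hp2 hgy hx
  have hI : ∀ a c, IntervalIntegrable (fun r => b (y r)) MeasureTheory.volume a c := fun a c =>
    (hb.continuous.comp h.finVar.cont).intervalIntegrable a c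
  set c : ℝ → ℝ := fun r => max s (min r t) with hc
  have hcm : Monotone c := monotone_clamp s t
  have hcmem : ∀ r, c r ∈ Icc s t := clamp_mem hst
  have hcid : ∀ r ∈ Icc s t, c r = r := fun r hr => clamp_of_mem hr
  have hcs : c s = s := hcid s ⟨le_rfl, hst⟩
  set P : ℝ → F := fun r => ξ + (∫ q in s..c r, b (y q)) + J s (c r) with hP
  have hincr : ∀ u w, u ≤ w →
      P w - P u = (∫ q in c u..c w, b (y q)) + J (c u) (c w) := fun u w huw => by
    simp only [hP]
    rw [hadd s (c u) (c w) (hcmem u).1 (hcm huw),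
      ← intervalIntegral.integral_add_adjacent_intervals (hI s (c u)) (hI (c u) (c w))]
    abel
  set M₁ := ‖b 0‖ + Lb * (‖ξ‖ + 1) with hM₁
  set M₂ := ‖g 0‖ + Cg * (‖ξ‖ + 1) + constK p * Cg with hM₂
  have hM₁0 : 0 ≤ M₁ := by positivity
  have hM₂0 : 0 ≤ M₂ := by positivity
  have hle : ∀ u w, u ≤ w → ‖P w - P u‖ ≤ M₁ * (c w - c u) + M₂ * pv p x (c u) (c w) := by
    intro u w huw
    have hcu := hcm huw
    have h1 := (hJ _ _ hcu).norm_le hp hp2 hgy hx hcu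
    have h2 : ‖∫ q in c u..c w, b (y q)‖ ≤ M₁ * |c w - c u| :=
      intervalIntegral.norm_integral_le_of_norm_le_const fun r _ =>
        (norm_le_affine_of_lipschitz hb _).trans
          (add_le_add_right (mul_le_mul_of_nonneg_left (h.norm_le hp hst r) Lb.2) _)
    rw [abs_of_nonneg (sub_nonneg.2 hcu)] at h2
    have h3 : ‖g (y (c u))‖ ≤ ‖g 0‖ + Cg * (‖ξ‖ + 1) :=
      (norm_le_affine_of_lipschitz hg _).trans
        (add_le_add_right (mul_le_mul_of_nonneg_left (h.norm_le hp hst _) Cg.2) _)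
    have h4 : pv p (fun r => g (y r)) (c u) (c w) ≤ Cg * 1 :=
      (h.finVar.pv_lipschitz_le hp0 hg hcu).trans (mul_le_mul_of_nonneg_left
        ((h.finVar.mono hp0 (hcmem u).1 (hcmem w).2).trans h.pv_le) Cg.2)
    have h5 : ‖g (y (c u))‖ + constK p * pv p (fun r => g (y r)) (c u) (c w) ≤ M₂ := by
      have := mul_le_mul_of_nonneg_left h4 hK.le
      linarith
    have h6 := mul_le_mul_of_nonneg_right h5
      (pv_nonneg (p := p) (x := x) (a := c u) (b := c w))
    rw [hincr u w huw]
    refine (norm_add_le _ _).trans ?_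
    linarith
  have hmono : Monotone fun r : ℝ => M₁ * r := fun r q h => mul_le_mul_of_nonneg_left h hM₁0
  have hctl := ((IsCtl.of_monotone hp hmono).add hp ((hx.isCtl hp0).smul hM₂0)).comp hcm
  have hle' : ∀ u w, u ≤ w → ‖P w - P u‖ ≤
      (M₁ * c w - M₁ * c u) + M₂ * pv p x (c u) (c w) := fun u w huw =>
    (hle u w huw).trans (le_of_eq (by ring))
  have hPc : Continuous P := continuous_of_norm_sub_le_pv hp hx hM₁0 hM₂0 fun u w huw => by
    refine (hle u w huw).trans ?_
    -- Unless the clamped interval is a point, it is contained in `[u, w]`.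
    rcases (hcm huw).eq_or_lt with h1 | h1
    · rw [h1, sub_self, mul_zero, hx.pv_self hp0, mul_zero, add_zero]
      exact add_nonneg (mul_nonneg hM₁0 (by linarith)) (mul_nonneg hM₂0 pv_nonneg)
    · have h2 : u ≤ c u := by
        have h3 : c u < t := h1.trans_le (hcmem w).2
        by_contra! h4
        rcases le_total u t with h5 | h5
        · have h6 : min u t ≤ c u := le_max_right _ _
          rw [min_eq_left h5] at h6
          linarith
        · have h6 : min u t ≤ c u := le_max_right _ _
          rw [min_eq_right h5] at h6
          linarith
      have h3 : c w ≤ w := by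
        have h4 : s < c w := (hcmem u).1.trans_lt h1
        rcases max_choice s (min w t) with h5 | h5
        · exact absurd h5 h4.ne'
        · exact (h5.le).trans (min_le_left _ _)
      exact add_le_add (mul_le_mul_of_nonneg_left (by linarith) hM₁0)
        (mul_le_mul_of_nonneg_left (hx.mono hp0 h2 h3) hM₂0)
  refine ⟨P, ⟨finVar_of_ctl hp0 hctl hPc hle', ?_, ?_, fun r => ?_⟩, fun u w hsu huw hwt => ?_⟩
  · have : J s s = 0 := by simpa using hadd s s s le_rfl le_rfl
    simp [hP, hcs, this]
  · have h1 := pv_le_of_ctl (x := P) hp0 hctl hst fun u w _ huw _ => hle' u w huw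
    refine h1.trans ?_
    simp only [hcs, hcid t ⟨hst, le_rfl⟩]
    linarith
  · simp only [hP]
    rw [hcid _ (hcmem r)]
  · have hu : c u = u := hcid u ⟨hsu, huw.trans hwt⟩
    have hw : c w = w := hcid w ⟨hsu.trans huw, hwt⟩
    have h1 := hJ u w huw
    convert h1 using 1
    rw [hincr u w huw, hu, hw]
    abel

lemma exists_solOn_of_small (hp : 1 ≤ p) (hp2 : p < 2) (hx : FinVar p x)
    (hb : LipschitzWith Lb b) (hg : LipschitzWith Cg g) (hg1 : Differentiable ℝ g)
    (hg2 : LipschitzWith C' (fderiv ℝ g)) (hst : s ≤ t) (ξ : F)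
    (hsmall : (‖b 0‖ + Lb * (‖ξ‖ + 1)) * (t - s) +
      (‖g 0‖ + Cg * (‖ξ‖ + 1) + constK p * Cg) * pv p x s t ≤ 1)
    (hcontr : Lb * (t - s) + (Cg + constK p * (Cg + C' * 2)) * pv p x s t ≤ 1 / 2) :
    ∃ y, SolOn p b g x s t y ∧ y s = ξ := by
  have hp0 : 0 < p := by linarith
  have hK := constK_pos hp hp2
  have himg := fun (y : {y : ℝ → F // IsPicardPath p s t ξ y}) =>
    y.2.exists_image hp hp2 hx hb hg hst hsmall
  choose Φ hΦ hΦeq using himg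
  have hcont : ∀ {y : ℝ → F}, FinVar p y → ∀ a c, IntervalIntegrable
      (fun r => b (y r)) MeasureTheory.volume a c := fun hy a c =>
    (hb.continuous.comp hy.cont).intervalIntegrable a c
  have hlip : ∀ y z : {y : ℝ → F // IsPicardPath p s t ξ y},
      pv p (fun r => Φ y r - Φ z r) s t ≤ 1 / 2 * pv p (fun r => y.1 r - z.1 r) s t := by
    intro y z
    have h1 := pv_picard_sub_le (P := fun r => Φ y r - Φ z r) hp hp2 hx hb hg hg1 hg2 y.2.finVar
      z.2.finVar (y.2.init.trans z.2.init.symm) hst fun u w hsu huw hwt => by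
        convert (hΦeq y u w hsu huw hwt).sub (hΦeq z u w hsu huw hwt) using 1
        rw [intervalIntegral.integral_sub (hcont y.2.finVar _ _) (hcont z.2.finVar _ _)]
        abel
    refine h1.trans (mul_le_mul_of_nonneg_right (le_trans ?_ hcontr) pv_nonneg)
    -- The `2` in the contraction condition: both paths have variation at most one.
    have h2 : pv p y.1 s t + pv p z.1 s t ≤ 2 := by
      linarith [y.2.pv_le, z.2.pv_le]
    have h3 : (Cg : ℝ) + constK p * (Cg + C' * (pv p y.1 s t + pv p z.1 s t)) ≤
        Cg + constK p * (Cg + C' * 2) := by gcongr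
    exact add_le_add_right (mul_le_mul_of_nonneg_right h3 pv_nonneg) _
  have hξ : IsPicardPath p s t ξ (fun _ => ξ) := ⟨finVar_const hp ξ, rfl, by
    have := pv_le_of_ctl (x := fun _ : ℝ => ξ) hp0
      (IsCtl.of_monotone hp monotone_const (Φ := fun _ => 0)) hst (by simp)
    linarith, fun _ => rfl⟩
  set Y : ℕ → {y : ℝ → F // IsPicardPath p s t ξ y} := fun n =>
    Nat.rec ⟨_, hξ⟩ (fun _ y => ⟨Φ y, hΦ y⟩) n with hY
  have hYsucc : ∀ n, (Y (n + 1)).1 = Φ (Y n) := fun n => rfl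
  have hpv : ∀ n m, pv p (fun r => (Y (m + n)).1 r - (Y n).1 r) s t ≤ (1 / 2) ^ n := by
    intro n
    induction n with
    | zero =>
      intro m
      have h1 := (Y m).2
      rw [pow_zero]
      refine le_trans (pv_le_of_ctl hp0 (h1.finVar.isCtl hp0) hst fun u w _ huw _ => ?_) h1.pv_le
      simpa [hY] using h1.finVar.norm_sub_le hp0 huw
    | succ n ih =>
      intro m
      rw [← add_assoc, hYsucc, hYsucc, pow_succ']
      exact (hlip _ _).trans (mul_le_mul_of_nonneg_left (ih m) (by norm_num))
  have hdist : ∀ {y z : ℝ → F}, IsPicardPath p s t ξ y → IsPicardPath p s t ξ z → ∀ r,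
      ‖y r - z r‖ ≤ pv p (fun r => y r - z r) s t := by
    intro y z hy hz r
    have h0 := clamp_mem hst r
    have h1 := hy.finVar.sub hp hz.finVar
    have h2 := (h1.norm_sub_le hp0 h0.1).trans (h1.mono hp0 le_rfl h0.2)
    rw [hy.eq_clamp r, hz.eq_clamp r]
    simpa [hy.init, hz.init] using h2
  have hcauchy : ∀ r, CauchySeq fun n => (Y n).1 r := fun r =>
    cauchySeq_of_le_geometric (1 / 2) 1 (by norm_num) fun n => by
      rw [dist_comm, dist_eq_norm, one_mul, add_comm]
      exact (hdist (Y _).2 (Y _).2 r).trans (hpv n 1)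
  choose y hy using fun r => cauchySeq_tendsto_of_complete (hcauchy r)
  have hshift : ∀ n r, Tendsto (fun m => (Y (m + n)).1 r - (Y n).1 r) atTop
      (𝓝 (y r - (Y n).1 r)) := fun n r =>
    ((tendsto_add_atTop_iff_nat n).2 (hy r)).sub_const _
  have hyY : ∀ n r, ‖y r - (Y n).1 r‖ ≤ (1 / 2) ^ n := fun n r =>
    le_of_tendsto' (hshift n r).norm fun m => (hdist (Y _).2 (Y _).2 r).trans (hpv n m)
  have hgeo : Tendsto (fun n : ℕ => (1 / 2 : ℝ) ^ n) atTop (𝓝 0) :=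
    tendsto_pow_atTop_nhds_zero_of_lt_one (by norm_num) (by norm_num)
  have hycont : Continuous y := by
    have : TendstoUniformly (fun n => (Y n).1) y atTop := by
      rw [Metric.tendstoUniformly_iff]
      intro ε hε
      filter_upwards [hgeo.eventually (gt_mem_nhds hε)] with n hn r
      rw [dist_eq_norm]
      exact (hyY n r).trans_lt hn
    exact this.continuous (Frequently.of_forall fun n => (Y n).2.finVar.cont)
  have hyinit : y s = ξ := tendsto_nhds_unique (hy s) (by
    simp only [(Y _).2.init]; exact tendsto_const_nhds)
  have hyclamp : ∀ r, y r = y (max s (min r t)) := fun r =>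
    tendsto_nhds_unique (hy r) ((hy _).congr fun n => ((Y n).2.eq_clamp r).symm)
  -- Being constant outside `[s, t]`, the iterates have variation at most one on every interval,
  -- which lower semicontinuity passes to the limit.
  have hpvY : ∀ n a c, pv p (Y n).1 a c ≤ 1 := by
    intro n a c
    have h1 : pVar p (Y n).1 a c ≤ pVar p (Y n).1 (max s (min a t)) (max s (min c t)) := by
      conv_lhs => rw [show (Y n).1 = fun r => (Y n).1 (max s (min r t)) from
        funext (Y n).2.eq_clamp]
      exact pVar_comp_le hp0 (monotone_clamp s t)
    refine (ENNReal.toReal_mono ((Y n).2.finVar.fin _ _) h1).trans ?_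
    exact ((Y n).2.finVar.mono hp0 (clamp_mem hst a).1 (clamp_mem hst c).2).trans (Y n).2.pv_le
  have hypv : ∀ a c, pVar p y a c ≤ ENNReal.ofReal 1 := fun a c =>
    pVar_le_of_tendsto hp0 (fun r _ => hy r) zero_le_one (fun n => (Y n).2.finVar.fin a c)
      (Eventually.of_forall fun n => hpvY n a c)
  have hyP : IsPicardPath p s t ξ y :=
    ⟨⟨hycont, fun a c => ne_top_of_le_ne_top ENNReal.ofReal_ne_top (hypv a c)⟩, hyinit,
      ENNReal.toReal_le_of_le_ofReal zero_le_one (hypv s t), hyclamp⟩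
  have hypvY : ∀ n, pv p (fun r => y r - (Y n).1 r) s t ≤ (1 / 2) ^ n := fun n =>
    ENNReal.toReal_le_of_le_ofReal (by positivity)
      (pVar_le_of_tendsto hp0 (fun r _ => hshift n r) (by positivity)
        (fun m => ((Y _).2.finVar.sub hp (Y _).2.finVar).fin s t)
        (Eventually.of_forall fun m => hpv n m))
  -- The image of `y` and `Y (n + 1)` are the images of `y` and `Y n`, so their distance is at most
  -- half of `(1 / 2) ^ n`.
  have hfix : ∀ r, Φ ⟨y, hyP⟩ r = y r := by
    intro r
    refine tendsto_nhds_unique ?_ ((tendsto_add_atTop_iff_nat 1).2 (hy r))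
    refine tendsto_const_nhds.congr_dist ?_
    refine squeeze_zero (fun n => dist_nonneg) (fun n => ?_) hgeo
    rw [dist_eq_norm]
    have h1 := hdist (hΦ ⟨y, hyP⟩) (Y (n + 1)).2 r
    have h2 := hlip ⟨y, hyP⟩ (Y n)
    have h3 := hypvY n
    have h4 : (0 : ℝ) ≤ (1 / 2) ^ n := by positivity
    rw [hYsucc] at h1 ⊢
    simp only at h2
    linarith
  refine ⟨y, ⟨hyP.finVar, fun u w hsu huw hwt => ?_⟩, hyinit⟩
  have h1 := hΦeq ⟨y, hyP⟩ u w hsu huw hwt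
  rwa [hfix, hfix] at h1

/-- Local existence, on intervals whose length depends only on a bound for the initial value. -/
lemma exists_solOn_local (hp : 1 ≤ p) (hp2 : p < 2) (hx : FinVar p x)
    (hb : LipschitzWith Lb b) (hg : LipschitzWith Cg g) (hg1 : Differentiable ℝ g)
    (hg2 : LipschitzWith C' (fderiv ℝ g)) (R : ℝ) :
    ∃ η > 0, ∀ s t, s ≤ t → t - s ≤ η → pv p x s t ≤ η → ∀ ξ, ‖ξ‖ ≤ R →
      ∃ y, SolOn p b g x s t y ∧ y s = ξ := by
  have hK := constK_pos hp hp2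
  set a₁ := ‖b 0‖ + Lb * (|R| + 1) with h₁
  set a₂ := ‖g 0‖ + Cg * (|R| + 1) + constK p * Cg with h₂
  set a₃ := Cg + constK p * (Cg + C' * 2) with h₃
  have ha₁ : 0 ≤ a₁ := by positivity
  have ha₂ : 0 ≤ a₂ := by positivity
  have ha₃ : 0 ≤ a₃ := by positivity
  have hLb : (0 : ℝ) ≤ Lb := Lb.2
  set c := a₁ + a₂ + a₃ + Lb + 1 with hc
  have hc0 : 0 < c := by positivity
  refine ⟨1 / (2 * c), by positivity, fun s t hst hts hxst ξ hξ => ?_⟩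
  have hη : c * (1 / (2 * c)) = 1 / 2 := by field_simp
  set η := 1 / (2 * c) with hηdef
  have hη0 : 0 < η := by positivity
  have hξ' : ‖ξ‖ ≤ |R| := hξ.trans (le_abs_self R)
  have key : ∀ {A B : ℝ}, 0 ≤ A → 0 ≤ B → A + B ≤ c → A * (t - s) + B * pv p x s t ≤ 1 / 2 := by
    intro A B hA hB hAB
    have i1 := mul_le_mul_of_nonneg_left hts hA
    have i2 := mul_le_mul_of_nonneg_left hxst hB
    have i3 := mul_le_mul_of_nonneg_right hAB hη0.le
    linarith
  refine exists_solOn_of_small hp hp2 hx hb hg hg1 hg2 hst ξ ?_ ?_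
  · have h1 := key (A := ‖b 0‖ + Lb * (‖ξ‖ + 1))
      (B := ‖g 0‖ + Cg * (‖ξ‖ + 1) + constK p * Cg) (by positivity) (by positivity) (by
        have i1 : ‖b 0‖ + Lb * (‖ξ‖ + 1) ≤ a₁ := by rw [h₁]; gcongr
        have i2 : ‖g 0‖ + Cg * (‖ξ‖ + 1) + constK p * Cg ≤ a₂ := by rw [h₂]; gcongr
        linarith)
    linarith
  · exact key hLb ha₃ (by linarith)

/-- Global existence on compact intervals. -/
theorem exists_solOn (hp : 1 ≤ p) (hp2 : p < 2) (hx : FinVar p x)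
    (hb : LipschitzWith Lb b) (hg : LipschitzWith Cg g) (hg1 : Differentiable ℝ g)
    (hg2 : LipschitzWith C' (fderiv ℝ g)) {T : ℝ} (hT : 0 ≤ T) (y₀ : F) :
    ∃ y, SolOn p b g x 0 T y ∧ y 0 = y₀ := by
  have hp0 : 0 < p := by linarith
  have hK := constK_pos hp hp2
  -- The growth bound needs positive constants, so both Lipschitz constants are enlarged by one.
  have hCg1 : (0 : ℝ≥0) < Cg + 1 := by positivity
  have hg' : LipschitzWith (Cg + 1) g := hg.weaken (by simp)
  have hL1 : (0 : ℝ) < Lb + 1 := by positivity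
  have hbL : ∀ z, ‖b z‖ ≤ (Lb + 1 : ℝ) * ‖z‖ + ‖b 0‖ := fun z => by
    have := norm_le_affine_of_lipschitz hb z
    have := norm_nonneg z
    linarith
  have hγ : 0 < constGamma p (Cg + 1 : ℝ≥0) := by
    have : (0 : ℝ) < (Cg + 1 : ℝ≥0) := by exact_mod_cast hCg1
    unfold constGamma
    positivity
  obtain ⟨δ₁, hδ₁, hsm₁⟩ := hx.exists_small hp 0 T hγ
  obtain ⟨n₁, hn₁⟩ := exists_nat_ge (T / (δ₁ / 2))
  rw [div_le_iff₀ (by positivity)] at hn₁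
  set M := constM0 p (Lb + 1) (Cg + 1 : ℝ≥0) ‖b 0‖ ‖g 0‖ with hM
  have hM0 : 0 ≤ M := by rw [hM]; unfold constM0; positivity
  -- This bound depends on `T` but not on how far the solution has been continued, so one local step
  -- length works throughout.
  set R := (‖y₀‖ + M * n₁) *
    Real.exp (constAlpha p * n₁ + 2 * (Lb + 1) * (T - 0)) with hR
  have hapriori : ∀ t, 0 ≤ t → t ≤ T → ∀ y, SolOn p b g x 0 t y → y 0 = y₀ → ‖y t‖ ≤ R := by
    intro t ht htT y hy hy0
    set τ : ℕ → ℝ := fun k => min (k * (δ₁ / 2)) t with hτ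
    have hτ0 : τ 0 = 0 := by simp [hτ, ht]
    have hτn : τ n₁ = t := min_eq_right (htT.trans hn₁)
    have hstep : ∀ k : ℕ, ((k + 1 : ℕ) : ℝ) * (δ₁ / 2) = k * (δ₁ / 2) + δ₁ / 2 := fun k => by
      push_cast; ring
    have hτmono : ∀ k, τ k ≤ τ (k + 1) := fun k =>
      min_le_min_right t (by rw [hstep]; linarith)
    have hτnn : ∀ k, 0 ≤ τ k := fun k => le_min (by positivity) ht
    have h := SolOn.norm_add_pv_le (y := y) (τ := τ) hp hp2 hx hg' hCg1 hL1
      (norm_nonneg (b 0)) hbL n₁ (fun k _ => hτmono k) (fun k _ => by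
        refine (hsm₁ _ _ (hτnn k) (hτmono k) ((min_le_right _ _).trans htT) ?_).le
        have : τ (k + 1) ≤ τ k + δ₁ / 2 := by
          simp only [hτ]
          rw [hstep, ← min_add_add_right]
          exact min_le_min_left _ (by linarith)
        linarith) (by rwa [hτ0, hτn])
    rw [hτ0, hτn, hy0] at h
    have h1 := hy.finVar.norm_sub_le hp0 ht
    have h2 := norm_le_norm_add_norm_sub' (y t) (y 0)
    rw [hy0] at h1 h2
    refine (h2.trans (by linarith)).trans (h.trans ?_)
    rw [hR]
    gcongr
  obtain ⟨η, hη, hloc⟩ := exists_solOn_local hp hp2 hx hb hg hg1 hg2 R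
  obtain ⟨δ₂, hδ₂, hsm₂⟩ := hx.exists_small hp 0 T hη
  set δ := min η (δ₂ / 2) with hδ
  have hδ0 : 0 < δ := lt_min hη (by positivity)
  have hall : ∀ k : ℕ, ∃ y, SolOn p b g x 0 (min (k * δ) T) y ∧ y 0 = y₀ := by
    intro k
    induction k with
    | zero =>
      have h0 : min (((0 : ℕ) : ℝ) * δ) T = 0 := by simp [hT]
      rw [h0]
      refine ⟨fun _ => y₀, ⟨finVar_const hp y₀, fun u v hu huv hv => ?_⟩, rfl⟩
      obtain rfl : u = 0 := le_antisymm (huv.trans hv) hu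
      obtain rfl : v = 0 := le_antisymm hv huv
      intro ε hε
      refine ⟨1, one_pos, fun n t ht _ => ?_⟩
      have : ∀ i ≤ n, t i = 0 := fun i hi => by
        have := ht.mem hi
        exact le_antisymm this.2 this.1
      rw [Finset.sum_eq_zero fun i hi => by
        have := Finset.mem_range.1 hi
        simp [‹∀ i ≤ n, t i = 0› i (by omega), ‹∀ i ≤ n, t i = 0› (i + 1) (by omega)]]
      simpa using hε
    | succ k ih =>
      obtain ⟨y, hy, hy0⟩ := ih
      set u := min (k * δ) T with hu
      set v := min ((k + 1 : ℕ) * δ) T with hv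
      have hstep : ((k + 1 : ℕ) : ℝ) * δ = k * δ + δ := by push_cast; ring
      have hu0 : 0 ≤ u := le_min (by positivity) hT
      have huv : u ≤ v := min_le_min_right T (by rw [hstep]; linarith)
      have hd : v - u ≤ δ := by
        have : v ≤ u + δ := by
          rw [hu, hv, hstep, ← min_add_add_right]
          exact min_le_min_left _ (by linarith)
        linarith
      obtain ⟨z, hz, hzu⟩ := hloc u v huv (hd.trans (min_le_left _ _))
        (hsm₂ u v hu0 huv (min_le_right _ _)
          (by have := hd.trans (min_le_right _ _); linarith)).le (y u)
        (hapriori u hu0 (min_le_right _ _) y hy hy0)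
      obtain ⟨w, hw, hw0⟩ := hy.glue hp hp2 hx hg hb.continuous hu0 hz hzu.symm
      exact ⟨w, hw, hw0.trans hy0⟩
  obtain ⟨k, hk⟩ := exists_nat_ge (T / δ)
  rw [div_le_iff₀ hδ0] at hk
  have := hall k
  rwa [min_eq_right hk] at this

end Existence

/-! ### Greedy times -/

section Greedy

variable {E : Type*} [NormedAddCommGroup E] {p γ : ℝ} {x : ℝ → E} {a b : ℝ}

lemma greedyTime_mem (hab : a ≤ b) (k : ℕ) : greedyTime p γ x a b k ∈ Icc a b := by
  induction k with
  | zero => exact ⟨le_rfl, hab⟩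
  | succ k ih =>
    rw [greedyTime]
    have hlb : greedyTime p γ x a b k ∈ lowerBounds (insert b
        {t : ℝ | greedyTime p γ x a b k < t ∧
          pVar p x (greedyTime p γ x a b k) t = ENNReal.ofReal γ}) := by
      rintro t (rfl | ht)
      · exact ih.2
      · exact ht.1.le
    exact ⟨ih.1.trans (le_csInf (insert_nonempty _ _) hlb), csInf_le ⟨_, hlb⟩ (mem_insert _ _)⟩

lemma greedyTime_le_succ (hab : a ≤ b) (k : ℕ) :
    greedyTime p γ x a b k ≤ greedyTime p γ x a b (k + 1) := by
  conv_rhs => rw [greedyTime]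
  refine le_csInf (insert_nonempty _ _) ?_
  rintro t (rfl | ht)
  · exact (greedyTime_mem hab k).2
  · exact ht.1.le

lemma greedyTime_succ_le (hab : a ≤ b) (k : ℕ) {t : ℝ} (ht : greedyTime p γ x a b k < t)
    (ht' : pVar p x (greedyTime p γ x a b k) t = ENNReal.ofReal γ) :
    greedyTime p γ x a b (k + 1) ≤ t := by
  rw [greedyTime]
  refine csInf_le ⟨greedyTime p γ x a b k, ?_⟩ (mem_insert_of_mem _ ⟨ht, ht'⟩)
  rintro r (rfl | hr)
  · exact (greedyTime_mem hab k).2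
  · exact hr.1.le

/-- If the variation exceeded `γ`, it would by continuity equal `γ` at some earlier time,
contradicting the infimum. -/
lemma pv_greedyTime_le (hp : 1 ≤ p) (hx : FinVar p x) (hγ : 0 < γ) (hab : a ≤ b) (k : ℕ) :
    pv p x (greedyTime p γ x a b k) (greedyTime p γ x a b (k + 1)) ≤ γ := by
  by_contra! hcon
  have hle := greedyTime_le_succ (p := p) (γ := γ) (x := x) hab k
  have hsucc := fun t => greedyTime_succ_le (p := p) (γ := γ) (x := x) hab k (t := t)
  set s := greedyTime p γ x a b k
  set s' := greedyTime p γ x a b (k + 1)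
  have h0 := hx.pv_self (a := s) (by linarith)
  obtain ⟨u, hu, hu'⟩ : γ ∈ pv p x s '' Icc s s' :=
    intermediate_value_Icc hle ((hx.continuousOn_pv hp s).mono Icc_subset_Ici_self)
      ⟨by rw [h0]; exact hγ.le, hcon.le⟩
  have h1 : s < u := lt_of_le_of_ne hu.1 fun h => by
    rw [← h, h0] at hu'
    exact hγ.ne hu'
  have h2 : s' ≤ u := hsucc u h1 (by rw [← hx.ofReal_pv, hu'])
  have h3 : u = s' := le_antisymm hu.2 h2
  rw [h3] at hu'
  exact hcon.ne' hu'

/-- If the variation stayed below `γ` at the infimum, it would stay below `γ` slightly beyond it, so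
no hitting time could be near. -/
lemma pv_greedyTime_eq (hp : 1 ≤ p) (hx : FinVar p x) (hγ : 0 < γ) (hab : a ≤ b) (k : ℕ)
    (hk : greedyTime p γ x a b (k + 1) < b) :
    pv p x (greedyTime p γ x a b k) (greedyTime p γ x a b (k + 1)) = γ := by
  have hp0 : 0 < p := by linarith
  refine le_antisymm (pv_greedyTime_le hp hx hγ hab k) ?_
  by_contra! hcon
  have hle := greedyTime_le_succ (p := p) (γ := γ) (x := x) hab k
  obtain ⟨u, hu, hu'⟩ := hx.exists_small_right hp0 (greedyTime p γ x a b (k + 1))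
    (sub_pos.2 hcon)
  have hadd := hx.pv_add_le hp hle hu.le
  have hlt : sInf (insert b {t : ℝ | greedyTime p γ x a b k < t ∧
      pVar p x (greedyTime p γ x a b k) t = ENNReal.ofReal γ}) < min u b := by
    have := lt_min hu hk
    rwa [greedyTime] at this
  obtain ⟨t, ht, htu⟩ := exists_lt_of_csInf_lt (insert_nonempty _ _) hlt
  rcases ht with rfl | ht
  · exact absurd htu (not_lt.2 (min_le_right _ _))
  · have h1 : pv p x (greedyTime p γ x a b k) t = γ := by
      rw [pv, ht.2, ENNReal.toReal_ofReal hγ.le]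
    have h2 := hx.mono hp0 (le_refl (greedyTime p γ x a b k))
      (htu.le.trans (min_le_left _ _))
    linarith

lemma greedyTime_greedyCount (hp : 1 ≤ p) (hx : FinVar p x) (hγ : 0 < γ) (hab : a ≤ b) :
    greedyTime p γ x a b (greedyCount p γ x a b) = b := by
  have hp0 : 0 < p := by linarith
  -- An empty set would give the default infimum `0`. Nonemptiness holds because each step ending
  -- before `b` uses up `γ ^ p` of the finite total `pv p x a b ^ p`.
  suffices h : {k : ℕ | greedyTime p γ x a b k = b}.Nonempty from Nat.sInf_mem h
  by_contra hcon
  rw [not_nonempty_iff_eq_empty, eq_empty_iff_forall_notMem] at hcon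
  have hlt : ∀ k, greedyTime p γ x a b k < b := fun k =>
    lt_of_le_of_ne (greedyTime_mem hab k).2 (hcon k)
  obtain ⟨n, hn⟩ := exists_nat_gt (pv p x a b ^ p / γ ^ p)
  rw [div_lt_iff₀ (by positivity)] at hn
  have h1 := ((hx.isCtl hp0).sum_le (t := greedyTime p γ x a b) n
    fun i _ => greedyTime_le_succ hab i).2
  rw [Finset.sum_congr rfl fun i _ => by
    rw [pv_greedyTime_eq hp hx hγ hab i (hlt (i + 1))]] at h1
  simp only [Finset.sum_const, Finset.card_range, nsmul_eq_mul] at h1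
  have h2 := hx.mono hp0 (greedyTime_mem (p := p) (γ := γ) (x := x) hab 0).1
    (greedyTime_mem (p := p) (γ := γ) (x := x) hab n).2
  have h3 := Real.rpow_le_rpow pv_nonneg h2 hp0.le
  linarith

end Greedy

/-! ### Solutions on the half-line -/

section Main

variable {E F : Type*} [NormedAddCommGroup E] [NormedSpace ℝ E]
    [NormedAddCommGroup F] [NormedSpace ℝ F] {p : ℝ} {A : F →L[ℝ] F} {f : F → F}
    {g : F → E →L[ℝ] F} {x : ℝ → E} {y z : ℝ → F} {s t u : ℝ} {Cf Cg : ℝ≥0}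

lemma pVar_mono_left {G : Type*} [NormedAddCommGroup G] {w : ℝ → G} (hp : 0 < p) (hsu : s ≤ u) :
    pVar p w u t ≤ pVar p w s t := by
  by_cases htop : pVar p w s t = ∞
  · simp [htop]
  rw [← ENNReal.ofReal_toReal htop]
  refine pVar_le_of_sum_le hp ENNReal.toReal_nonneg fun n τ hτ => ?_
  obtain ⟨v, hv, hsum⟩ := (isPartition_two hsu).append hτ fun r q => ‖w q - w r‖ ^ p
  have h1 := sum_le_of_pVar_ne_top hp htop hv
  rw [hsum] at h1
  refine le_trans (le_add_of_nonneg_left ?_) h1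
  exact Finset.sum_nonneg fun i _ => by positivity

lemma isSolution_of_solOn
    (h : ∀ n : ℕ, ∃ z, SolOn p (fun z => A z + f z) g x 0 n z ∧ EqOn y z (Icc 0 n)) :
    IsSolution p A f g x y := by
  refine ⟨fun t ht => ?_, fun T hT => ?_, fun t ht => ?_⟩
  · obtain ⟨n, hn⟩ := exists_nat_gt t
    obtain ⟨z, hz, hyz⟩ := h n
    refine (hz.finVar.cont.continuousWithinAt).congr_of_eventuallyEq ?_ (hyz ⟨ht, hn.le⟩)
    filter_upwards [self_mem_nhdsWithin, nhdsWithin_le_nhds (Iio_mem_nhds hn)] with r hr hrn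
    exact hyz ⟨hr, le_of_lt hrn⟩
  · obtain ⟨n, hn⟩ := exists_nat_ge T
    obtain ⟨z, hz, hyz⟩ := h n
    rw [pVar_congr (hyz.mono (Icc_subset_Icc_right hn))]
    exact (hz.finVar.fin 0 T).lt_top
  · obtain ⟨n, hn⟩ := exists_nat_ge t
    obtain ⟨z, hz, hyz⟩ := h n
    have hsub := hyz.mono (Icc_subset_Icc_right hn)
    have h1 := hz.eqn 0 t le_rfl ht hn
    have h2 : ∫ r in (0 : ℝ)..t, (A (y r) + f (y r)) = ∫ r in (0 : ℝ)..t, (A (z r) + f (z r)) := by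
      refine intervalIntegral.integral_congr fun r hr => ?_
      rw [uIcc_of_le ht] at hr
      simp only [hsub hr]
    refine ⟨_, h1.congr (fun r hr => by simp only [hsub hr]) fun _ _ => rfl, ?_⟩
    rw [h2, hsub ⟨ht, le_rfl⟩, hsub ⟨le_rfl, ht⟩]
    abel

lemma lipschitz_drift (A : F →L[ℝ] F) (hf : LipschitzWith Cf f) :
    LipschitzWith (‖A‖₊ + Cf) fun z => A z + f z :=
  A.lipschitz.add hf

variable [ProperSpace F]

/-- Freezing `y` at its initial value for negative times gives a path on all of `ℝ`, and subtracting
the equations at two times gives the incremental form. -/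
lemma IsSolution.solOn (hp : 1 ≤ p) (hp2 : p < 2) (hx : FinVar p x) (hf : LipschitzWith Cf f)
    (hg : LipschitzWith Cg g) (h : IsSolution p A f g x y) (T : ℝ) :
    SolOn p (fun z => A z + f z) g x 0 T (fun r => y (max r 0)) := by
  have hp0 : 0 < p := by linarith
  obtain ⟨hc, hfin, heqn⟩ := h
  have hm : Monotone fun r : ℝ => max r 0 := fun _ _ h => max_le_max_right 0 h
  have hy : FinVar p fun r => y (max r 0) := by
    refine ⟨hc.comp_continuous (by fun_prop) fun r => mem_Ici.2 (le_max_right _ _), fun a c => ?_⟩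
    exact ne_top_of_le_ne_top (hfin (max c 0) (le_max_right _ _)).ne
      ((pVar_comp_le hp0 hm).trans (pVar_mono_left hp0 (le_max_right _ _)))
  have hcont : Continuous fun r => A (y (max r 0)) + f (y (max r 0)) :=
    (A.continuous.comp hy.cont).add (hf.continuous.comp hy.cont)
  have key : ∀ t, 0 ≤ t → HasYoungIntegral (fun r => g (y (max r 0))) x 0 t
      (y (max t 0) - y 0 - ∫ r in (0 : ℝ)..t, (A (y (max r 0)) + f (y (max r 0)))) := by
    intro t ht
    obtain ⟨I, hI, hyt⟩ := heqn t ht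
    have h1 : ∫ r in (0 : ℝ)..t, (A (y (max r 0)) + f (y (max r 0))) =
        ∫ r in (0 : ℝ)..t, (A (y r) + f (y r)) := by
      refine intervalIntegral.integral_congr fun r hr => ?_
      rw [uIcc_of_le ht] at hr
      simp only [max_eq_left hr.1]
    rw [h1, max_eq_left ht, hyt]
    have h2 : y 0 + (∫ r in (0 : ℝ)..t, (A (y r) + f (y r))) + I - y 0 -
        ∫ r in (0 : ℝ)..t, (A (y r) + f (y r)) = I := by abel
    rw [h2]
    exact hI.congr (fun r hr => by simp only [max_eq_left hr.1]) fun _ _ => rfl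
  refine ⟨hy, fun u v hu huv _ => ?_⟩
  have h1 := (key u hu).tail hp hp2 (hy.lipschitz hp0 hg) hx hu huv (key v (hu.trans huv))
  convert h1 using 1
  rw [← intervalIntegral.integral_add_adjacent_intervals (hcont.intervalIntegrable 0 u)
    (hcont.intervalIntegrable u v)]
  abel

lemma IsSolution.eqOn {C' : ℝ≥0} (hp : 1 ≤ p) (hp2 : p < 2) (hx : FinVar p x)
    (hf : LipschitzWith Cf f) (hg : LipschitzWith Cg g) (hg1 : Differentiable ℝ g)
    (hg2 : LipschitzWith C' (fderiv ℝ g)) (hy : IsSolution p A f g x y)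
    (hz : IsSolution p A f g x z) (h0 : y 0 = z 0) : EqOn y z (Ici 0) := by
  intro t ht
  have h := (hy.solOn hp hp2 hx hf hg t).eqOn hp hp2 hx (lipschitz_drift A hf) hg hg1 hg2
    (hz.solOn hp hp2 hx hf hg t) (by simpa using h0) ⟨ht, le_rfl⟩
  simpa [max_eq_left (mem_Ici.1 ht)] using h

lemma exists_isSolution {C' : ℝ≥0} (hp : 1 ≤ p) (hp2 : p < 2) (hx : FinVar p x)
    (hf : LipschitzWith Cf f) (hg : LipschitzWith Cg g) (hg1 : Differentiable ℝ g)
    (hg2 : LipschitzWith C' (fderiv ℝ g)) (A : F →L[ℝ] F) (y₀ : F) :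
    ∃ y, IsSolution p A f g x y ∧ y 0 = y₀ := by
  have hb := lipschitz_drift A hf
  choose Y hY hY0 using fun n : ℕ =>
    exists_solOn hp hp2 hx hb hg hg1 hg2 (Nat.cast_nonneg n) y₀
  -- By uniqueness the solutions on `[0, n]` are consistent, so at time `t` the first available one
  -- may be used.
  refine ⟨fun t => Y ⌈t⌉₊ t, isSolution_of_solOn fun n => ⟨Y n, hY n, fun t ht => ?_⟩, hY0 _⟩
  have h1 : ⌈t⌉₊ ≤ n := Nat.ceil_le.2 ht.2
  exact (hY ⌈t⌉₊).eqOn hp hp2 hx hb hg hg1 hg2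
    ((hY n).restrict le_rfl (by exact_mod_cast h1)) ((hY0 _).trans (hY0 _).symm)
    ⟨ht.1, Nat.le_ceil t⟩

lemma constGamma_pos (hp : 1 ≤ p) (hp2 : p < 2) (hCg : 0 < Cg) : 0 < constGamma p Cg := by
  have := constK_pos hp hp2
  unfold constGamma
  positivity

/-- The growth bound along the greedy times. -/
theorem IsSolution.norm_add_pv_le (hp : 1 ≤ p) (hp2 : p < 2) (hx : FinVar p x)
    (hf : LipschitzWith Cf f) (hg : LipschitzWith Cg g) (hy : IsSolution p A f g x y)
    (hL : 0 < ‖A‖ + Cf) (hCg : 0 < Cg) {a b : ℝ} (ha : 0 ≤ a) (hab : a ≤ b) :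
    ‖y a‖ + pv p (fun r => y (max r 0)) a b ≤
      (‖y a‖ + constM0 p (‖A‖ + Cf) Cg ‖f 0‖ ‖g 0‖ * greedyCount p (constGamma p Cg) x a b) *
        Real.exp (constAlpha p * greedyCount p (constGamma p Cg) x a b +
          2 * (‖A‖ + Cf) * (b - a)) := by
  have hγ := constGamma_pos hp hp2 hCg
  have hN := greedyTime_greedyCount hp hx hγ hab
  have h := SolOn.norm_add_pv_le (τ := greedyTime p (constGamma p Cg) x a b)
    (y := fun r => y (max r 0)) (b := fun z => A z + f z) hp hp2 hx hg hCg hL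
    (norm_nonneg (f 0)) (fun z => by
      have h1 := norm_le_affine_of_lipschitz (lipschitz_drift A hf) z
      simp only [map_zero, zero_add, NNReal.coe_add, coe_nnnorm] at h1
      linarith) (greedyCount p (constGamma p Cg) x a b)
    (fun k _ => greedyTime_le_succ hab k) (fun k _ => pv_greedyTime_le hp hx hγ hab k)
    ((hy.solOn hp hp2 hx hf hg b).restrict ha hN.le)
  rw [hN] at h
  simpa only [greedyTime, max_eq_left ha] using h

end Main

end YDE

end

theorem theorem2 (d m : ℕ) (p : ℝ) (hp1 : 1 < p) (hp2 : p < 2)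
    (A : EuclideanSpace ℝ (Fin d) →L[ℝ] EuclideanSpace ℝ (Fin d))
    (f : EuclideanSpace ℝ (Fin d) → EuclideanSpace ℝ (Fin d))
    (g : EuclideanSpace ℝ (Fin d) → EuclideanSpace ℝ (Fin m) →L[ℝ] EuclideanSpace ℝ (Fin d))
    (Cf Cg : ℝ≥0) (hf : LipschitzWith Cf f) (hg : LipschitzWith Cg g)
    (hg1 : ContDiff ℝ 1 g) (hg2 : ∃ C : ℝ≥0, LipschitzWith C (fderiv ℝ g))
    (x : ℝ → EuclideanSpace ℝ (Fin m)) (hx : Continuous x)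
    (hxp : ∀ a b : ℝ, a ≤ b → YDE.pVar p x a b < ∞) :
    (∀ y₀ : EuclideanSpace ℝ (Fin d),
      (∃ y : ℝ → EuclideanSpace ℝ (Fin d), YDE.IsSolution p A f g x y ∧ y 0 = y₀) ∧
      (∀ y z : ℝ → EuclideanSpace ℝ (Fin d),
        YDE.IsSolution p A f g x y → y 0 = y₀ → YDE.IsSolution p A f g x z → z 0 = y₀ →
        Set.EqOn y z (Set.Ici 0))) ∧
    (∀ L γ α M₀ : ℝ, L = ‖A‖ + Cf → 0 < L → 0 < Cg → γ = YDE.constGamma p Cg →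
      α = YDE.constAlpha p → M₀ = YDE.constM0 p L Cg ‖f 0‖ ‖g 0‖ →
      ∀ y : ℝ → EuclideanSpace ℝ (Fin d), YDE.IsSolution p A f g x y →
      ∀ a b : ℝ, 0 ≤ a → a < b → ∀ N : ℕ, N = YDE.greedyCount p γ x a b →
        YDE.greedyTime p γ x a b N = b ∧
        YDE.supNorm y a b ≤
          ENNReal.ofReal ((‖y a‖ + M₀ * N) * Real.exp (α * N + 2 * L * (b - a))) ∧
        YDE.pVarNorm p y a b ≤
          ENNReal.ofReal ((‖y a‖ + M₀ * N) * Real.exp (α * N + 2 * L * (b - a)) *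
            (N : ℝ) ^ ((p - 1) / p))) := by
  have hp : 1 ≤ p := hp1.le
  have hp0 : 0 < p := by linarith
  have hxF : YDE.FinVar p x := ⟨hx, fun a b => by
    rcases le_or_gt a b with h | h
    · exact (hxp a b h).ne
    · simp [YDE.pVar_of_lt hp0 h]⟩
  have hg1' : Differentiable ℝ g := hg1.differentiable one_ne_zero
  obtain ⟨C', hC'⟩ := hg2
  refine ⟨fun y₀ => ⟨YDE.exists_isSolution hp hp2 hxF hf hg hg1' hC' A y₀,
    fun y z hy hy0 hz hz0 => hy.eqOn hp hp2 hxF hf hg hg1' hC' hz (hy0.trans hz0.symm)⟩, ?_⟩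
  rintro L γ α M₀ rfl hL hCg rfl rfl rfl y hy a b ha hab N rfl
  have hN := YDE.greedyTime_greedyCount hp hxF (YDE.constGamma_pos hp hp2 hCg) hab.le
  have hmain := hy.norm_add_pv_le hp hp2 hxF hf hg hL hCg ha hab.le
  set N := YDE.greedyCount p (YDE.constGamma p Cg) x a b
  have hN1 : (1 : ℝ) ≤ N := by
    have : N ≠ 0 := fun h => by
      rw [h] at hN
      exact hab.ne hN
    exact_mod_cast Nat.one_le_iff_ne_zero.2 this
  have hyF := (hy.solOn hp hp2 hxF hf hg b).finVar
  refine ⟨hN, iSup₂_le fun t ht => ?_, ?_⟩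
  · rw [← ofReal_norm]
    refine ENNReal.ofReal_le_ofReal (le_trans ?_ hmain)
    have h1 := (hyF.norm_sub_le hp0 ht.1).trans (hyF.mono hp0 le_rfl ht.2)
    simp only [max_eq_left ha, max_eq_left (ha.trans ht.1)] at h1
    have h2 := norm_le_norm_add_norm_sub' (y t) (y a)
    linarith
  · have hcongr : YDE.pVar p y a b = YDE.pVar p (fun r => y (max r 0)) a b :=
      YDE.pVar_congr fun r hr => by simp only [max_eq_left (ha.trans hr.1)]
    rw [YDE.pVarNorm, hcongr, ← hyF.ofReal_pv, ← ofReal_norm,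
      ← ENNReal.ofReal_add (norm_nonneg _) YDE.pv_nonneg]
    -- The bound already holds without the power of `N`, which is at least one because `a < b`
    -- forces `N ≥ 1`.
    refine ENNReal.ofReal_le_ofReal (hmain.trans (le_mul_of_one_le_right ?_ ?_))
    · exact le_trans (add_nonneg (norm_nonneg _) YDE.pv_nonneg) hmain
    · exact Real.one_le_rpow hN1 (div_nonneg (by linarith) hp0.le)
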